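/- Let $|\cdot|$ denote the Euclidean norm, and for $\vec x=(x_1,\dots,x_d)\in\mathbb R^d$ put $\underline{\vec x}=(x_1,\dots,x_{d-1})$. For $\alpha=(\alpha_1,\dots,\alpha_{d-1},1)\in\pi_d=\{\vec x\in\mathbb R^d : x_d=1\}$ let $L_\alpha(\vec x)=\alpha_1x_1+\dots+\alpha_{d-1}x_{d-1}+x_d$. A vector $\vec z\in\mathbb Z^d$ with $\underline{\vec z}\neq 0$ is called a best approximation vector for $L_\alpha$ if $|L_\alpha(\vec z)|\le|L_\alpha(\vec z')|$ for every $\vec z'\in\mathbb Z^d$ with $0<|\underline{\vec z'}|\le|\underline{\vec z}|$, with strict inequality whenever $0<|\underline{\vec z'}|<|\underline{\vec z}|$. A unit vector $\vec u\in\mathbb R^d$ is called an asymptotic direction for best approximation vectors for $L_\alpha$ if it is an accumulation point of the set $\{\vec z/|\vec z| : \vec z \text{ is a best approximation vector for } L_\alpha\}$. Theorem. Let $d\ge 3$ be an integer, let $\beta>0$ be real, and set $f_d(\beta)=(d-2)\beta^2+(2d-3)\beta$. Then there is an $\alpha\in\pi_d$ such that: (i) there are constants $c_1,c_2>0$, depending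 only on $d$, $\beta$ and $\alpha$, such that every best approximation vector $\vec z\in\mathbb Z^d$ for $L_\alpha$ satisfies $$c_1|\vec z|^{-f_d(\beta)}\le|L_\alpha(\vec z)|\cdot|\vec z|^{d-1}\le c_2|\vec z|^{-f_d(\beta)};$$ (ii) there is a constant $c_3>0$, depending only on $d$, $\beta$ and $\alpha$, such that every $\vec z\in\mathbb Z^d$ that is not an integer multiple of a best approximation vector for $L_\alpha$ satisfies $$|L_\alpha(\vec z)|\cdot|\vec z|^{d-1}\ge c_3|\vec z|^{-f_d(\beta)+(d-1)\beta};$$ (iii) the set of asymptotic directions for best approximation vectors for $L_\alpha$ consists of exactly two pairs of opposite points, that is, it equals $\{\pm\vec u,\pm\vec v\}$ for some unit vectors $\vec u,\vec v$ with $\vec u\ne\pm\vec v$. -/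

import Mathlib

noncomputable section

namespace DiophForm

/-- `x ↦ (x_1, …, x_{d-1})`, dropping the last coordinate. -/
def truncate {d : ℕ} (x : EuclideanSpace ℝ (Fin d)) : EuclideanSpace ℝ (Fin (d - 1)) :=
  WithLp.toLp 2 fun i => x (Fin.castLE (Nat.sub_le d 1) i)

/-- The affine hyperplane `π_d = {x ∈ ℝ^d | x_d = 1}`
(the `d`-th coordinate is the one with index `d - 1` in `Fin d`). -/
def affinePlane (d : ℕ) : Set (EuclideanSpace ℝ (Fin d)) :=
  {x | ∀ i : Fin d, (i : ℕ) + 1 = d → x i = 1}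

/-- The integer vector `z ∈ ℤ^d`, seen as a point of Euclidean `ℝ^d`. -/
def intVec {d : ℕ} (z : Fin d → ℤ) : EuclideanSpace ℝ (Fin d) :=
  WithLp.toLp 2 fun i => (z i : ℝ)

/-- The linear form `L_α(x) = ⟨α, x⟩`. -/
def linForm {d : ℕ} (α x : EuclideanSpace ℝ (Fin d)) : ℝ :=
  inner ℝ α x

/-- `z ∈ ℤ^d` is a best approximation vector for `L_α`. -/
def IsBestApprox {d : ℕ} (α : EuclideanSpace ℝ (Fin d)) (z : Fin d → ℤ) : Prop :=
  truncate (intVec z) ≠ 0 ∧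
  ∀ z' : Fin d → ℤ, 0 < ‖truncate (intVec z')‖ →
    (‖truncate (intVec z')‖ ≤ ‖truncate (intVec z)‖ →
      |linForm α (intVec z)| ≤ |linForm α (intVec z')|) ∧
    (‖truncate (intVec z')‖ < ‖truncate (intVec z)‖ →
      |linForm α (intVec z)| < |linForm α (intVec z')|)

/-- The set of all `z / |z|`, where `z` is a best approximation vector for `L_α`. -/
def bestApproxDirections {d : ℕ} (α : EuclideanSpace ℝ (Fin d)) :
    Set (EuclideanSpace ℝ (Fin d)) :=
  {u | ∃ z : Fin d → ℤ, IsBestApprox α z ∧ u = ‖intVec z‖⁻¹ • intVec z}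

/-- The set of asymptotic directions for best approximation vectors for `L_α`: the unit vectors
that are accumulation points of the set of all `z / |z|`. -/
def asymptoticDirections {d : ℕ} (α : EuclideanSpace ℝ (Fin d)) :
    Set (EuclideanSpace ℝ (Fin d)) :=
  {u | ‖u‖ = 1 ∧ AccPt u (Filter.principal (bestApproxDirections α))}

/-- `f_d(β) = (d - 2) β² + (2d - 3) β`. -/
def typeExponent (d : ℕ) (β : ℝ) : ℝ :=
  ((d : ℝ) - 2) * β ^ 2 + (2 * (d : ℝ) - 3) * β

end DiophForm

end

/-! Write d = e + 3 and L for the form. The form is built together with its best approximations `z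
k`. Integers `X k` with `X (k + 1)` of order `X k ^ (1 + β)` prescribe sizes, and `z k, y k 1, …, y
k e, z (k + 1), z (k + 2)` are bases of ℤ^d, each obtained from the previous one by a unimodular
step whose multipliers are quotients of scales. Divided by `X k` and `X (k + 2)` respectively, `z k`
and `y k i` move by summable amounts along the recursion: for k ≥ 1 the vector `z k` stays near e₁
(k odd) or e₂ - e₁ (k even), and `y k i` with i ≥ 1 stays near a fixed standard vector (`near_aux`).

The α with last coordinate 1 whose values decrease along the k-th basis and are nonnegative form
nested nonempty compact sets; the required α is a common point (`exists_form_decreasing`). The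
recursion then makes L(z k) comparable to c^e a L(z (k + 1)), where c, a are the multipliers, and
this telescopes to L(z k) ≍ 1 / (X (k + 1) X (k + 2)^(d - 2)) (`volume_mono`, `volume_le`). In terms
of |z k| the exponent is -((1 + β) + (d - 2)(1 + β)²) = -(d - 1) - f_d(β), which gives (i).

An integer vector v short compared with `X (k + 2)` is m z_k + w, where the coefficients of w are
controlled because the remaining basis vectors, normalised and truncated, are close to a fixed frame
(`coeff_le`). Hence L(v) differs from m L(z_k) by at most (1 + |m|)/4 · L(z_k), and w is a multiple
of z_{k+1} if |m| ≤ 1 (`exists_approx`). Consecutive truncated `z k` form an obtuse angle, so adding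
multiples of z_{k+1} never helps, and the best approximations are exactly ±`z k`, k ≥ 1
(`minimal_form`, `isBestApprox_iff`). Vectors not proportional to these satisfy |L(v)| ≥ L(z_k)/2
(`half_form_le`), which gives (ii).

The two parity classes of directions converge to two non-parallel limits in the kernel of L. They
never reach them because L(z k) > 0, so the limits are accumulation points, which gives (iii). -/

namespace DiophForm

/-! ### Scales growing like a power 1 + β -/

/-- Integer scales `X k` with `X k ∣ X (k + 1)` and rapidly growing quotients;
`c k = X (k + 3) / X (k + 2)` and `a k = X (k + 3) / X (k + 1)`. -/
structure IsScale (D : ℕ) (X a c : ℕ → ℕ) : Prop where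
  zero : X 0 = 1
  one : X 1 = 1
  two : X 2 = 1
  mul_c : ∀ k, X (k + 3) = c k * X (k + 2)
  mul_a : ∀ k, X (k + 3) = a k * X (k + 1)
  le_c : ∀ k, 16 * D * 2 ^ k ≤ c k

/-- Rounding λ(1 + β)^k costs only a bounded error in the recursion. The scales will be powers of 2
with these exponents, so that they divide each other. -/
theorem exists_exponents {β : ℝ} (hβ : 0 < β) (M : ℕ) :
    ∃ n : ℕ → ℕ, n 0 = 0 ∧ n 1 = 0 ∧ n 2 = 0 ∧ (∀ k, n (k + 2) + (M + k) ≤ n (k + 3)) ∧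
      ∃ C : ℝ, ∀ k, |(n (k + 1) : ℝ) - (1 + β) * n k| ≤ C := by
  -- Chosen so that λβ(1 + kβ) ≥ M + k + 1; Bernoulli's inequality then yields the linear gap.
  set lam : ℝ := (M + 1) / β + 1 / β ^ 2 with hlam
  have hlam0 : 0 < lam := by positivity
  set ν : ℕ → ℝ := fun k => lam * (1 + β) ^ k with hν
  have hν0 : ∀ k, 0 ≤ ν k := fun k => by simp only [hν]; positivity
  have hmono : ∀ k, ν k ≤ ν (k + 1) := fun k => by
    simp only [hν]
    gcongr
    · linarith
    · omega
  have hm1 : ∀ k, ⌊ν k⌋₊ ≤ ⌊ν (k + 1)⌋₊ := fun k => Nat.floor_le_floor (hmono k)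
  have hmon : Monotone fun k => ⌊ν k⌋₊ := monotone_nat_of_le_succ hm1
  have hgap : ∀ k, ν k + (M + k + 1) ≤ ν (k + 1) := fun k => by
    have h1 : ν (k + 1) - ν k = lam * β * (1 + β) ^ k := by simp only [hν]; ring
    have h2 : 1 + (k : ℝ) * β ≤ (1 + β) ^ k := one_add_mul_le_pow (by linarith) k
    have h3 : lam * β = (M + 1) + 1 / β := by rw [hlam]; field_simp
    have h4 : lam * β * (1 + (k : ℝ) * β) ≤ lam * β * (1 + β) ^ k := by gcongr
    have h5 : lam * β * (1 + (k : ℝ) * β) = (M + 1) + 1 / β + (M + 1) * k * β + k := by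
      rw [h3]; field_simp; ring
    have h6 : 0 ≤ 1 / β + (M + 1) * (k : ℝ) * β := by positivity
    linarith
  -- The truncated subtraction makes the first three exponents zero.
  refine ⟨fun k => ⌊ν k⌋₊ - ⌊ν 2⌋₊, ?_, ?_, by simp, ?_, ?_⟩
  · simpa [Nat.sub_eq_zero_iff_le] using hmon (by norm_num : 0 ≤ 2)
  · simpa [Nat.sub_eq_zero_iff_le] using hmon (by norm_num : 1 ≤ 2)
  · intro k
    have h1 : ⌊ν 2⌋₊ ≤ ⌊ν (k + 2)⌋₊ := hmon (by omega)
    have h2 : ⌊ν (k + 2)⌋₊ + (M + k) ≤ ⌊ν (k + 2 + 1)⌋₊ := by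
      apply Nat.le_floor
      have := hgap (k + 2)
      have h3 := Nat.floor_le (hν0 (k + 2))
      push_cast at this ⊢
      linarith
    show ⌊ν (k + 2)⌋₊ - ⌊ν 2⌋₊ + (M + k) ≤ ⌊ν (k + 2 + 1)⌋₊ - ⌊ν 2⌋₊
    omega
  · have key : ∀ k, |((⌊ν k⌋₊ - ⌊ν 2⌋₊ : ℕ) : ℝ) - ν k| ≤ ν 2 + 1 := fun k => by
      have h1 := Nat.floor_le (hν0 k)
      have h2 := Nat.lt_floor_add_one (ν k)
      have h3 := Nat.floor_le (hν0 2)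
      have h4 : ((⌊ν k⌋₊ - ⌊ν 2⌋₊ : ℕ) : ℝ) ≤ ⌊ν k⌋₊ := by exact_mod_cast Nat.sub_le _ _
      have h5 : (⌊ν k⌋₊ : ℝ) ≤ ((⌊ν k⌋₊ - ⌊ν 2⌋₊ : ℕ) : ℝ) + ⌊ν 2⌋₊ := by
        exact_mod_cast le_tsub_add
      have h6 := hν0 2
      rw [abs_le]; constructor <;> linarith
    refine ⟨(ν 2 + 1) + (1 + β) * (ν 2 + 1), fun k => ?_⟩
    have h1 := key (k + 1)
    have h2 := key k
    have h3 : ν (k + 1) = (1 + β) * ν k := by simp only [hν]; ring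
    have h4 : (((⌊ν (k + 1)⌋₊ - ⌊ν 2⌋₊ : ℕ) : ℝ)) - (1 + β) * ((⌊ν k⌋₊ - ⌊ν 2⌋₊ : ℕ) : ℝ) =
        ((((⌊ν (k + 1)⌋₊ - ⌊ν 2⌋₊ : ℕ) : ℝ)) - ν (k + 1)) -
          (1 + β) * (((⌊ν k⌋₊ - ⌊ν 2⌋₊ : ℕ) : ℝ) - ν k) := by rw [h3]; ring
    show |((⌊ν (k + 1)⌋₊ - ⌊ν 2⌋₊ : ℕ) : ℝ) - (1 + β) * ((⌊ν k⌋₊ - ⌊ν 2⌋₊ : ℕ) : ℝ)| ≤ _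
    rw [h4]
    refine (abs_sub _ _).trans (add_le_add h1 ?_)
    rw [abs_mul, abs_of_pos (by linarith : 0 < 1 + β)]
    gcongr

theorem exists_scale {β : ℝ} (hβ : 0 < β) (D : ℕ) :
    ∃ X a c : ℕ → ℕ, IsScale D X a c ∧ ∃ C : ℝ, 0 < C ∧ ∀ k,
      (X (k + 1) : ℝ) ≤ C * (X k : ℝ) ^ (1 + β) ∧ (X k : ℝ) ^ (1 + β) ≤ C * X (k + 1) := by
  obtain ⟨n, h0, h1, h2, hn, C, hC⟩ := exists_exponents hβ (16 * D)
  have hmono : ∀ k, n (k + 1) ≤ n (k + 2) := fun k => by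
    rcases k with _ | k
    · simp [h1]
    · have := hn k; show n (k + 2) ≤ n (k + 3); omega
  refine ⟨fun k => 2 ^ n k, fun k => 2 ^ (n (k + 3) - n (k + 1)),
    fun k => 2 ^ (n (k + 3) - n (k + 2)), ⟨by simp [h0], by simp [h1], by simp [h2], ?_, ?_, ?_⟩,
    2 ^ C, by positivity, ?_⟩
  · intro k
    have := hn k
    rw [← pow_add]; congr 1; omega
  · intro k
    have := hn k
    have := hmono k
    rw [← pow_add]; congr 1; omega
  · intro k
    have := hn k
    calc 16 * D * 2 ^ k ≤ 2 ^ (16 * D) * 2 ^ k := by gcongr; exact Nat.lt_two_pow_self.le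
      _ = 2 ^ (16 * D + k) := by rw [pow_add]
      _ ≤ _ := Nat.pow_le_pow_right (by norm_num) (by omega)
  · intro k
    have h := abs_le.1 (hC k)
    have e1 : ∀ m, (((2 ^ n m : ℕ)) : ℝ) = (2 : ℝ) ^ (n m : ℝ) := fun m => by
      push_cast; rw [Real.rpow_natCast]
    simp only [e1]
    rw [← Real.rpow_mul (by norm_num), ← Real.rpow_add (by norm_num),
      ← Real.rpow_add (by norm_num)]
    constructor <;> apply Real.rpow_le_rpow_of_exponent_le (by norm_num) <;> linarith

namespace IsScale

variable {D : ℕ} {X a c : ℕ → ℕ}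

theorem sixteen_le_c (h : IsScale D X a c) (hD : 0 < D) (k : ℕ) : 16 ≤ c k := by
  have h1 := h.le_c k
  have : 1 ≤ D * 2 ^ k := Nat.mul_pos hD (by positivity)
  nlinarith

theorem pos (h : IsScale D X a c) (hD : 0 < D) (k : ℕ) : 0 < X k := by
  induction k using Nat.strong_induction_on with
  | _ k ih =>
    match k with
    | 0 => simp [h.zero]
    | 1 => simp [h.one]
    | 2 => simp [h.two]
    | k + 3 =>
      rw [h.mul_c]
      exact Nat.mul_pos (by linarith [h.sixteen_le_c hD k]) (ih _ (by omega))

theorem monotone (h : IsScale D X a c) (hD : 0 < D) : Monotone X := by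
  refine monotone_nat_of_le_succ fun k => ?_
  match k with
  | 0 => simp [h.zero, h.one]
  | 1 => simp [h.one, h.two]
  | k + 2 =>
    rw [h.mul_c]
    exact Nat.le_mul_of_pos_left _ (by linarith [h.sixteen_le_c hD k])

theorem c_le_a (h : IsScale D X a c) (hD : 0 < D) (k : ℕ) : c k ≤ a k := by
  have h1 := h.mul_a k
  rw [h.mul_c] at h1
  by_contra! h2
  have h3 := h.monotone hD (show k + 1 ≤ k + 2 by omega)
  have h4 := h.pos hD (k + 1)
  nlinarith

theorem gap (h : IsScale D X a c) (k : ℕ) : 16 * D * 2 ^ k * X (k + 2) ≤ X (k + 3) := by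
  rw [h.mul_c]
  exact Nat.mul_le_mul_right _ (h.le_c k)

end IsScale

/-! ### The recursion of bases -/

/-- The recursion behind the construction: `y k 0 = z k, y k 1, …, y k e, z (k + 1), z (k + 2)`
is the `k`-th basis. -/
structure ChainRec {V : Type*} [AddCommGroup V] (e : ℕ) (a c : ℕ → ℕ) (z : ℕ → V)
    (y : ℕ → ℕ → V) : Prop where
  zero : ∀ k, y k 0 = z k
  succ : ∀ k i, i < e → y (k + 1) (i + 1) = c k • y k (i + 1) - y k i
  last : ∀ k, z (k + 3) = a k • z (k + 1) - y k e

theorem ChainRec.map {V W : Type*} [AddCommGroup V] [AddCommGroup W] {e : ℕ} {a c : ℕ → ℕ}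
    {z : ℕ → V} {y : ℕ → ℕ → V} (h : ChainRec e a c z y) (f : V →+ W) :
    ChainRec e a c (fun k => f (z k)) (fun k i => f (y k i)) where
  zero k := by simp [h.zero]
  succ k i hi := by simp [h.succ k i hi]
  last k := by simp [h.last]

section Existence

variable {V : Type*} [AddCommGroup V] (e : ℕ) (a c : ℕ → ℕ) (b : ℕ → V) (z₁ z₂ : V)

/-- The sequence of bases with initial basis `b 0, …, b e, z₁, z₂`. -/
def basisSeq : ℕ → (ℕ → V) × V × V
  | 0 => (b, z₁, z₂)
  | k + 1 => (fun i => Nat.casesOn i (basisSeq k).2.1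
        fun j => c k • (basisSeq k).1 (j + 1) - (basisSeq k).1 j,
      (basisSeq k).2.2, a k • (basisSeq k).2.1 - (basisSeq k).1 e)

theorem exists_chainRec : ∃ (z : ℕ → V) (y : ℕ → ℕ → V), ChainRec e a c z y ∧
    (∀ i, y 0 i = b i) ∧ z 1 = z₁ ∧ z 2 = z₂ :=
  ⟨fun k => (basisSeq e a c b z₁ z₂ k).1 0, fun k => (basisSeq e a c b z₁ z₂ k).1,
    ⟨fun _ => rfl, fun _ _ _ => rfl, fun _ => rfl⟩, fun _ => rfl, rfl, rfl⟩

end Existence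

section Span

variable {V : Type*} [AddCommGroup V] {e : ℕ} {a c : ℕ → ℕ} {z : ℕ → V} {y : ℕ → ℕ → V}

/-- Every additive subgroup containing the `(k + 1)`-st basis contains the `k`-th one. -/
theorem ChainRec.mem_of_succ (h : ChainRec e a c z y) (S : AddSubgroup V) (k : ℕ)
    (hy : ∀ i ≤ e, y (k + 1) i ∈ S) (h2 : z (k + 2) ∈ S) (h3 : z (k + 3) ∈ S) :
    (∀ i ≤ e, y k i ∈ S) ∧ z (k + 1) ∈ S ∧ z (k + 2) ∈ S := by
  have h1 : z (k + 1) ∈ S := by rw [← h.zero]; exact hy 0 (Nat.zero_le _)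
  refine ⟨fun i hi => ?_, h1, h2⟩
  -- The step is undone from the top: `last` recovers `y k e`, then `succ` recovers each `y k i`
  -- from `y k (i + 1)`.
  induction hi using Nat.decreasingInduction with
  | self =>
    have : y k e = a k • z (k + 1) - z (k + 3) := by rw [h.last]; abel
    rw [this]
    exact S.sub_mem (S.nsmul_mem h1 _) h3
  | of_succ i hi ih =>
    have : y k i = c k • y k (i + 1) - y (k + 1) (i + 1) := by rw [h.succ k i hi]; abel
    rw [this]
    exact S.sub_mem (S.nsmul_mem ih _) (hy _ hi)

theorem ChainRec.mem_zero (h : ChainRec e a c z y) (S : AddSubgroup V) (k : ℕ)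
    (hy : ∀ i ≤ e, y k i ∈ S) (h1 : z (k + 1) ∈ S) (h2 : z (k + 2) ∈ S) :
    (∀ i ≤ e, y 0 i ∈ S) ∧ z 1 ∈ S ∧ z 2 ∈ S := by
  induction k with
  | zero => exact ⟨hy, h1, h2⟩
  | succ k ih =>
    obtain ⟨h3, h4, h5⟩ := h.mem_of_succ S k hy h1 h2
    exact ih h3 h4 h5

end Span

/-! ### Values of a linear form along the recursion -/

section Real

variable {e : ℕ} {a c : ℕ → ℕ} {z : ℕ → ℝ} {y : ℕ → ℕ → ℝ}

/-- The values of a linear form on the `k`-th basis are nonnegative and decreasing. -/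
def IsDecreasingAt (e : ℕ) (z : ℕ → ℝ) (y : ℕ → ℕ → ℝ) (k : ℕ) : Prop :=
  0 ≤ z (k + 2) ∧ z (k + 2) ≤ z (k + 1) ∧ z (k + 1) ≤ y k e ∧ ∀ i < e, y k (i + 1) ≤ y k i

theorem IsDecreasingAt.antitone {k : ℕ} (h : IsDecreasingAt e z y k) {i j : ℕ} (hij : i ≤ j)
    (hj : j ≤ e) : y k j ≤ y k i := by
  induction j, hij using Nat.le_induction with
  | base => exact le_rfl
  | succ j _ ih => exact (h.2.2.2 j (by omega)).trans (ih (by omega))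

theorem IsDecreasingAt.z_le {k : ℕ} (h : IsDecreasingAt e z y k) {i : ℕ} (hi : i ≤ e) :
    z (k + 1) ≤ y k i := h.2.2.1.trans (h.antitone hi le_rfl)

theorem IsDecreasingAt.z_nonneg {k : ℕ} (h : IsDecreasingAt e z y k) : 0 ≤ z (k + 1) :=
  h.1.trans h.2.1

theorem IsDecreasingAt.y_nonneg {k : ℕ} (h : IsDecreasingAt e z y k) {i : ℕ} (hi : i ≤ e) :
    0 ≤ y k i := h.z_nonneg.trans (h.z_le hi)

/-- Solved backwards, the recursion multiplies by at least 2 and subtracts at most `z (k + 1)`, the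
largest value at stage `k + 1`. Going down in `i`, each `y k i` therefore dominates `y k (i + 1)`,
which is itself at least `z (k + 1)`. This makes the sets of admissible forms nested. -/
theorem IsDecreasingAt.of_succ (hr : ChainRec e a c z y) (ha : ∀ k, 2 ≤ a k) (hc : ∀ k, 2 ≤ c k)
    {k : ℕ} (h : IsDecreasingAt e z y (k + 1)) : IsDecreasingAt e z y k := by
  have ha' : (2 : ℝ) ≤ a k := by exact_mod_cast ha k
  have hc' : (2 : ℝ) ≤ c k := by exact_mod_cast hc k
  have h0 : y (k + 1) 0 = z (k + 1) := hr.zero _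
  have h2 : 0 ≤ z (k + 2) := h.z_nonneg
  have h21 : z (k + 2) ≤ z (k + 1) := h0 ▸ h.z_le (Nat.zero_le e)
  have h32 : z (k + 3) ≤ z (k + 2) := h.2.1
  have he : z (k + 1) ≤ y k e := by
    have := hr.last k
    rw [nsmul_eq_mul] at this
    nlinarith
  have hstep : ∀ i < e, z (k + 1) ≤ y k (i + 1) → y k (i + 1) ≤ y k i := fun i hi hz => by
    have h3 := hr.succ k i hi
    rw [nsmul_eq_mul] at h3
    have h4 : y (k + 1) (i + 1) ≤ z (k + 1) := h0 ▸ h.antitone (Nat.zero_le _) hi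
    nlinarith
  have hall : ∀ i ≤ e, z (k + 1) ≤ y k i := fun i hi => by
    induction hi using Nat.decreasingInduction with
    | self => exact he
    | of_succ i hi ih => exact ih.trans (hstep i hi ih)
  exact ⟨h2, h21, he, fun i hi => hstep i hi (hall _ hi)⟩

theorem IsDecreasingAt.of_le (hr : ChainRec e a c z y) (ha : ∀ k, 2 ≤ a k) (hc : ∀ k, 2 ≤ c k)
    {j k : ℕ} (hjk : j ≤ k) (h : IsDecreasingAt e z y k) : IsDecreasingAt e z y j := by
  induction hjk using Nat.decreasingInduction with
  | self => exact h
  | of_succ j _ ih => exact ih.of_succ hr ha hc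

variable (hr : ChainRec e a c z y) (hd : ∀ k, IsDecreasingAt e z y k)

include hr hd

theorem y_le_mul {k i : ℕ} (hi : i < e) : y k i ≤ c k * y k (i + 1) := by
  have h := hr.succ k i hi
  rw [nsmul_eq_mul] at h
  linarith [(hd (k + 1)).y_nonneg (show i + 1 ≤ e from hi)]

theorem mul_le_y {k i : ℕ} (hi : i < e) : (c k - 1) * y k (i + 1) ≤ y k i := by
  have h := hr.succ k i hi
  rw [nsmul_eq_mul] at h
  have h1 := (hd (k + 1)).antitone (Nat.zero_le _) (show i + 1 ≤ e from hi)
  rw [hr.zero] at h1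
  linarith [(hd k).z_le (show i + 1 ≤ e from hi)]

theorem y_last_le_mul (k : ℕ) : y k e ≤ a k * z (k + 1) := by
  have h := hr.last k
  rw [nsmul_eq_mul] at h
  linarith [(hd (k + 1)).1]

theorem mul_le_y_last (k : ℕ) : (a k - 1) * z (k + 1) ≤ y k e := by
  have h := hr.last k
  rw [nsmul_eq_mul] at h
  have : z (k + 3) ≤ z (k + 2) := (hd (k + 1)).2.1
  linarith [(hd k).2.1]

theorem z_le_mul (k : ℕ) : z k ≤ (c k : ℝ) ^ e * a k * z (k + 1) := by
  have : ∀ i ≤ e, z k ≤ (c k : ℝ) ^ i * y k i := fun i hi => by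
    induction i with
    | zero => simp [hr.zero]
    | succ i ih =>
      refine (ih (by omega)).trans ?_
      rw [pow_succ, mul_assoc]
      gcongr
      exact y_le_mul hr hd hi
  refine (this e le_rfl).trans ?_
  rw [mul_assoc]
  gcongr
  exact y_last_le_mul hr hd k

theorem mul_le_z (hc : ∀ k, 1 ≤ c k) (k : ℕ) :
    ((c k : ℝ) - 1) ^ e * (a k - 1) * z (k + 1) ≤ z k := by
  have hc' : (0 : ℝ) ≤ c k - 1 := by have : (1 : ℝ) ≤ c k := by exact_mod_cast hc k
                                     linarith
  have : ∀ i ≤ e, ((c k : ℝ) - 1) ^ i * y k i ≤ z k := fun i hi => by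
    induction i with
    | zero => simp [hr.zero]
    | succ i ih =>
      refine le_trans ?_ (ih (by omega))
      rw [pow_succ, mul_assoc]
      gcongr
      exact mul_le_y hr hd hi
  refine le_trans ?_ (this e le_rfl)
  rw [mul_assoc]
  gcongr
  exact mul_le_y_last hr hd k

/-- If the form vanishes on some `z k`, then it vanishes on the initial basis. -/
theorem eq_zero_of_z_eq_zero {k : ℕ} (hz : z k = 0) : z 0 = 0 := by
  induction k with
  | zero => exact hz
  | succ k ih =>
    refine ih (le_antisymm ?_ (hr.zero k ▸ (hd k).y_nonneg (Nat.zero_le e)))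
    simpa [hz] using z_le_mul hr hd k

theorem z_pos (h0 : 0 < z 0) (k : ℕ) : 0 < z k := by
  have h1 : 0 ≤ z k := hr.zero k ▸ (hd k).y_nonneg (Nat.zero_le e)
  exact lt_of_le_of_ne h1 fun h => h0.ne' (eq_zero_of_z_eq_zero hr hd h.symm)

variable {D : ℕ} {X : ℕ → ℕ} (hX : IsScale D X a c)

include hX

/-- The weight is designed to telescope: `c k` turns `X (k + 2)` into `X (k + 3)` and `a k` turns `X
(k + 1)` into `X (k + 3)`, so `c k ^ e * a k` is exactly the quotient of consecutive weights. -/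
theorem volume_mono_step (k : ℕ) : z k * (X (k + 1) * X (k + 2) ^ (e + 1)) ≤
    z (k + 1) * (X (k + 2) * X (k + 3) ^ (e + 1)) := by
  have h1 : (X (k + 3) : ℝ) = c k * X (k + 2) := by exact_mod_cast hX.mul_c k
  have h2 : (X (k + 3) : ℝ) = a k * X (k + 1) := by exact_mod_cast hX.mul_a k
  calc z k * (X (k + 1) * X (k + 2) ^ (e + 1))
      ≤ ((c k : ℝ) ^ e * a k * z (k + 1)) * (X (k + 1) * X (k + 2) ^ (e + 1)) := by
        gcongr; exact z_le_mul hr hd k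
    _ = z (k + 1) * (X (k + 2) * ((c k * X (k + 2)) ^ e * (a k * X (k + 1)))) := by ring
    _ = _ := by rw [← h1, ← h2]; ring

theorem volume_step (hD : 0 < D) (h0 : 0 < z 0) (k : ℕ) :
    z (k + 1) * (X (k + 2) * X (k + 3) ^ (e + 1)) * (1 - 1 / c k) ^ (e + 1) ≤
      z k * (X (k + 1) * X (k + 2) ^ (e + 1)) := by
  have h1 : (X (k + 3) : ℝ) = c k * X (k + 2) := by exact_mod_cast hX.mul_c k
  have h2 : (X (k + 3) : ℝ) = a k * X (k + 1) := by exact_mod_cast hX.mul_a k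
  have hc : 16 ≤ c k := hX.sixteen_le_c hD k
  have hca : c k ≤ a k := hX.c_le_a hD k
  have hc' : (16 : ℝ) ≤ c k := by exact_mod_cast hc
  have hca' : (c k : ℝ) ≤ a k := by exact_mod_cast hca
  have hz := z_pos hr hd h0 (k + 1)
  have h6 : (0 : ℝ) ≤ c k - 1 := by linarith
  have h3 : (1 - 1 / (c k : ℝ)) * a k ≤ a k - 1 := by
    have : 1 ≤ 1 / (c k : ℝ) * a k := by
      rw [one_div, inv_mul_eq_div, le_div_iff₀ (by linarith)]; linarith
    linarith
  have h4 : (1 - 1 / (c k : ℝ)) * c k = c k - 1 := by field_simp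
  have h5 : (0 : ℝ) ≤ 1 - 1 / c k := by
    rw [sub_nonneg, div_le_one (by linarith)]; linarith
  calc z (k + 1) * (X (k + 2) * X (k + 3) ^ (e + 1)) * (1 - 1 / c k) ^ (e + 1)
      = z (k + 1) * (X (k + 2) * (X (k + 3) ^ e * X (k + 3))) * (1 - 1 / c k) ^ (e + 1) := by
        ring
    _ = z (k + 1) * (X (k + 2) * ((c k * X (k + 2)) ^ e * (a k * X (k + 1)))) *
          (1 - 1 / c k) ^ (e + 1) := by
        congr 2; congr 1; congr 1
        · rw [h1]
    _ = (((1 - 1 / c k) * c k) ^ e * ((1 - 1 / c k) * a k) * z (k + 1)) *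
          (X (k + 1) * X (k + 2) ^ (e + 1)) := by
        generalize 1 - 1 / (c k : ℝ) = u
        ring
    _ ≤ (((c k : ℝ) - 1) ^ e * (a k - 1) * z (k + 1)) * (X (k + 1) * X (k + 2) ^ (e + 1)) := by
        rw [h4]
        gcongr
    _ ≤ _ := by
        gcongr
        exact mul_le_z hr hd (fun k => by linarith [hX.sixteen_le_c hD k]) k

theorem volume_mono (k : ℕ) : z 0 ≤ z k * (X (k + 1) * X (k + 2) ^ (e + 1)) := by
  induction k with
  | zero => simp [hX.one, hX.two]
  | succ k ih => exact ih.trans (volume_mono_step hr hd hX k)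

/-- Each step loses at most a factor `(1 - 1 / c k) ^ (e + 1)`, and the product of the `1 - 1 / c k`
stays above 1/2 since `c k ≥ 16 * 2 ^ k`. -/
theorem volume_le (hD : 0 < D) (h0 : 0 < z 0) (k : ℕ) :
    z k * (X (k + 1) * X (k + 2) ^ (e + 1)) ≤ 2 ^ (e + 1) * z 0 := by
  -- The quantity 1/2 + (1/2)^(k+1) starts at 1, remains above 1/2 and bounds the partial products
  -- from below.
  have key : ∀ k, z k * (X (k + 1) * X (k + 2) ^ (e + 1)) *
      (1 / 2 + (1 / 2) ^ (k + 1)) ^ (e + 1) ≤ z 0 := fun k => by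
    induction k with
    | zero => norm_num [hX.one, hX.two]
    | succ k ih =>
      refine le_trans ?_ ih
      have hz := z_pos hr hd h0 (k + 1)
      have h1 : (1 : ℝ) / 2 + (1 / 2) ^ (k + 2) ≤
          (1 - 1 / c k) * (1 / 2 + (1 / 2) ^ (k + 1)) := by
        have hp : (0 : ℝ) < 2 ^ k := by positivity
        have hp1 : (1 : ℝ) ≤ 2 ^ k := one_le_pow₀ (by norm_num)
        have h2 : (16 : ℝ) * 2 ^ k ≤ c k := by
          have h3 := hX.le_c k
          have h4 : 16 * 2 ^ k ≤ 16 * D * 2 ^ k := by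
            apply Nat.mul_le_mul_right; omega
          exact_mod_cast h4.trans h3
        have h3 : (1 : ℝ) / c k ≤ 1 / 16 * (1 / 2) ^ k := by
          rw [div_le_iff₀ (by linarith), one_div_pow]
          field_simp
          linarith
        have h4 : (0 : ℝ) < (1 / 2) ^ k := by positivity
        have h5 : ((1 : ℝ) / 2) ^ k ≤ 1 := pow_le_one₀ (by norm_num) (by norm_num)
        rw [pow_succ, pow_succ]
        nlinarith
      calc z (k + 1) * (X (k + 2) * X (k + 3) ^ (e + 1)) * (1 / 2 + (1 / 2) ^ (k + 2)) ^ (e + 1)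
          ≤ z (k + 1) * (X (k + 2) * X (k + 3) ^ (e + 1)) *
            ((1 - 1 / c k) * (1 / 2 + (1 / 2) ^ (k + 1))) ^ (e + 1) := by gcongr
        _ = z (k + 1) * (X (k + 2) * X (k + 3) ^ (e + 1)) * (1 - 1 / c k) ^ (e + 1) *
            (1 / 2 + (1 / 2) ^ (k + 1)) ^ (e + 1) := by rw [mul_pow]; ring
        _ ≤ _ := by
          exact mul_le_mul_of_nonneg_right (volume_step hr hd hX hD h0 k) (by positivity)
  have hz := z_pos hr hd h0 k
  have h1 : z k * (X (k + 1) * X (k + 2) ^ (e + 1)) * (1 / 2) ^ (e + 1) ≤ z 0 := by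
    refine le_trans ?_ (key k)
    gcongr
    have : (0 : ℝ) < (1 / 2) ^ (k + 1) := by positivity
    linarith
  rw [one_div_pow, mul_one_div, div_le_iff₀ (by positivity)] at h1
  linarith

end Real

/-! ### Lattice bases and existence of the form -/

theorem intVec_apply {d : ℕ} (v : Fin d → ℤ) (i : Fin d) : intVec v i = v i := rfl

/-- `intVec` as a homomorphism. -/
noncomputable def intVecHom (d : ℕ) : (Fin d → ℤ) →+ EuclideanSpace ℝ (Fin d) where
  toFun := intVec
  map_zero' := by ext i; simp [intVec_apply]
  map_add' v w := by ext i; simp [intVec_apply]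

theorem intVecHom_apply {d : ℕ} (v : Fin d → ℤ) : intVecHom d v = intVec v := rfl

/-- The restriction of `linForm α` to integer vectors, as a homomorphism. -/
noncomputable def formHom {d : ℕ} (α : EuclideanSpace ℝ (Fin d)) : (Fin d → ℤ) →+ ℝ :=
  (innerₗ (EuclideanSpace ℝ (Fin d)) α).toAddMonoidHom.comp (intVecHom d)

theorem formHom_apply {d : ℕ} (α : EuclideanSpace ℝ (Fin d)) (v : Fin d → ℤ) :
    formHom α v = linForm α (intVec v) := rfl

theorem formHom_smul {d : ℕ} (r : ℝ) (α : EuclideanSpace ℝ (Fin d)) (v : Fin d → ℤ) :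
    formHom (r • α) v = r * formHom α v := by
  simp [formHom_apply, linForm, real_inner_smul_left]

theorem continuous_formHom {d : ℕ} (v : Fin d → ℤ) :
    Continuous fun α : EuclideanSpace ℝ (Fin d) => formHom α v :=
  continuous_id.inner continuous_const

/-- The standard basis vector of `ℤ^d` with index `i` (zero if `d ≤ i`). -/
def stdVec (d i : ℕ) : Fin d → ℤ := fun j => if (j : ℕ) = i then 1 else 0

theorem formHom_stdVec {d : ℕ} (α : EuclideanSpace ℝ (Fin d)) (j : Fin d) :
    formHom α (stdVec d j) = α j := by
  have : ∀ i : Fin d, ((stdVec d j i : ℤ) : ℝ) * α i = if i = j then α i else 0 := fun i => by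
    simp [stdVec, Fin.ext_iff]
  simp [formHom_apply, linForm, PiLp.inner_apply, intVec_apply, this]

theorem eq_top_of_stdVec_mem {d : ℕ} (S : AddSubgroup (Fin d → ℤ))
    (h : ∀ i < d, stdVec d i ∈ S) : S = ⊤ := by
  rw [eq_top_iff]
  intro v _
  have : v = ∑ j : Fin d, v j • stdVec d j := by
    ext i
    simp [stdVec, Finset.sum_apply, ← Fin.ext_iff]
  rw [this]
  exact S.sum_mem fun j _ => S.zsmul_mem (h j j.2) _

/-- The sequence of lattice bases of `ℤ^(e+3)` used to construct `α`. -/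
structure IsLatticeSystem (e : ℕ) (X a c : ℕ → ℕ) (z : ℕ → Fin (e + 3) → ℤ)
    (y : ℕ → ℕ → Fin (e + 3) → ℤ) : Prop extends ChainRec e a c z y where
  scale : IsScale (e + 3) X a c
  z_zero : z 0 = stdVec _ (e + 2)
  z_one : z 1 = stdVec _ 0
  z_two : z 2 = stdVec _ 1 - stdVec _ 0
  y_zero : ∀ i < e, y 0 (i + 1) = stdVec _ (i + 2)

theorem exists_latticeSystem (e : ℕ) {X a c : ℕ → ℕ} (hX : IsScale (e + 3) X a c) :
    ∃ (z : ℕ → Fin (e + 3) → ℤ) (y : ℕ → ℕ → Fin (e + 3) → ℤ), IsLatticeSystem e X a c z y := by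
  obtain ⟨z, y, h, h0, h1, h2⟩ := exists_chainRec e a c
    (fun i => if i = 0 then stdVec (e + 3) (e + 2) else stdVec (e + 3) (i + 1))
    (stdVec (e + 3) 0) (stdVec (e + 3) 1 - stdVec (e + 3) 0)
  exact ⟨z, y, h, hX, by rw [← h.zero, h0]; simp, h1, h2, fun i _ => by rw [h0]; simp⟩

namespace IsLatticeSystem

variable {e : ℕ} {X a c : ℕ → ℕ} {z : ℕ → Fin (e + 3) → ℤ} {y : ℕ → ℕ → Fin (e + 3) → ℤ}
  (h : IsLatticeSystem e X a c z y)

include h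

/-- The `k`-th basis generates `ℤ^(e+3)`. -/
theorem eq_top (S : AddSubgroup (Fin (e + 3) → ℤ)) (k : ℕ) (hy : ∀ i ≤ e, y k i ∈ S)
    (h1 : z (k + 1) ∈ S) (h2 : z (k + 2) ∈ S) : S = ⊤ := by
  obtain ⟨h3, h4, h5⟩ := h.mem_zero S k hy h1 h2
  refine eq_top_of_stdVec_mem S fun i hi => ?_
  have h0 : stdVec (e + 3) 0 ∈ S := h.z_one ▸ h4
  rcases i with _ | _ | i
  · exact h0
  · have := S.add_mem h5 h0
    rwa [h.z_two, sub_add_cancel] at this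
  · rcases Nat.lt_or_ge i e with hie | hie
    · rw [← h.y_zero i hie]; exact h3 _ hie
    · obtain rfl : i = e := by omega
      rw [← h.z_zero, ← h.zero]
      exact h3 0 (Nat.zero_le _)

theorem exists_coeff (k : ℕ) (v : Fin (e + 3) → ℤ) : ∃ (m p q : ℤ) (r : ℕ → ℤ),
    v = m • z k + p • z (k + 1) + q • z (k + 2) + ∑ i ∈ Finset.range e, r i • y k (i + 1) := by
  let S : AddSubgroup (Fin (e + 3) → ℤ) :=
    { carrier := {v | ∃ (m p q : ℤ) (r : ℕ → ℤ), v = m • z k + p • z (k + 1) + q • z (k + 2) +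
        ∑ i ∈ Finset.range e, r i • y k (i + 1)}
      zero_mem' := ⟨0, 0, 0, 0, by simp⟩
      add_mem' := by
        rintro _ _ ⟨m, p, q, r, rfl⟩ ⟨m', p', q', r', rfl⟩
        refine ⟨m + m', p + p', q + q', r + r', ?_⟩
        simp only [Pi.add_apply, add_smul, Finset.sum_add_distrib]
        abel
      neg_mem' := by
        rintro _ ⟨m, p, q, r, rfl⟩
        refine ⟨-m, -p, -q, -r, ?_⟩
        simp only [Pi.neg_apply, neg_smul, Finset.sum_neg_distrib]
        abel }
  have : S = ⊤ := h.eq_top S k (fun i hi => by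
      rcases i with _ | i
      · exact ⟨1, 0, 0, 0, by simp [h.zero]⟩
      · refine ⟨0, 0, 0, Pi.single i 1, ?_⟩
        simp [Pi.single_apply, Finset.sum_ite_eq', show i < e from hi])
    ⟨0, 1, 0, 0, by simp⟩ ⟨0, 0, 1, 0, by simp⟩
  exact (this ▸ AddSubgroup.mem_top v : v ∈ S)

theorem form_rec (α : EuclideanSpace ℝ (Fin (e + 3))) :
    ChainRec e a c (fun k => formHom α (z k)) (fun k i => formHom α (y k i)) :=
  h.toChainRec.map _

theorem eq_zero_of_form {α : EuclideanSpace ℝ (Fin (e + 3))} {k : ℕ}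
    (hy : ∀ i ≤ e, formHom α (y k i) = 0) (h1 : formHom α (z (k + 1)) = 0)
    (h2 : formHom α (z (k + 2)) = 0) : α = 0 := by
  have := h.eq_top (formHom α).ker k hy h1 h2
  ext j
  rw [← formHom_stdVec, PiLp.zero_apply]
  have : stdVec (e + 3) j ∈ (formHom α).ker := this ▸ AddSubgroup.mem_top _
  exact this

omit h in
-- These are e + 2 vectors in dimension e + 3, so some nonzero α is orthogonal to them all.
theorem exists_form_vanishing (k : ℕ) : ∃ α : EuclideanSpace ℝ (Fin (e + 3)), α ≠ 0 ∧
    (∀ i < e, formHom α (y k (i + 1)) = 0) ∧ formHom α (z (k + 1)) = 0 ∧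
      formHom α (z (k + 2)) = 0 := by
  let f : Fin (e + 2) → EuclideanSpace ℝ (Fin (e + 3)) := fun i =>
    if (i : ℕ) < e then intVec (y k (i + 1)) else
      if (i : ℕ) = e then intVec (z (k + 1)) else intVec (z (k + 2))
  have h1 : Submodule.span ℝ (Set.range f) ≠ ⊤ := fun ht => by
    have h2 : Module.finrank ℝ (Submodule.span ℝ (Set.range f)) ≤ Fintype.card (Fin (e + 2)) :=
      finrank_range_le_card f
    rw [ht, finrank_top, finrank_euclideanSpace, Fintype.card_fin, Fintype.card_fin] at h2
    omega
  obtain ⟨α, hα, hα0⟩ := Submodule.exists_mem_ne_zero_of_ne_bot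
    (mt Submodule.orthogonal_eq_bot_iff.1 h1)
  have h3 : ∀ i : Fin (e + 2), linForm α (f i) = 0 := fun i => by
    rw [linForm, real_inner_comm]
    exact hα _ (Submodule.subset_span ⟨i, rfl⟩)
  refine ⟨α, hα0, fun i hi => ?_, ?_, ?_⟩
  · simpa [formHom_apply, f, hi] using h3 ⟨i, by omega⟩
  · simpa [formHom_apply, f] using h3 ⟨e, by omega⟩
  · simpa [formHom_apply, f] using h3 ⟨e + 1, by omega⟩

omit h in
theorem isDecreasingAt_smul {α : EuclideanSpace ℝ (Fin (e + 3))} {k : ℕ} {t : ℝ} (ht : 0 ≤ t)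
    (hα : IsDecreasingAt e (fun k => formHom α (z k)) (fun k i => formHom α (y k i)) k) :
    IsDecreasingAt e (fun k => formHom (t • α) (z k)) (fun k i => formHom (t • α) (y k i)) k := by
  simp only [IsDecreasingAt, formHom_smul] at hα ⊢
  exact ⟨mul_nonneg ht hα.1, mul_le_mul_of_nonneg_left hα.2.1 ht,
    mul_le_mul_of_nonneg_left hα.2.2.1 ht,
    fun i hi => mul_le_mul_of_nonneg_left (hα.2.2.2 i hi) ht⟩

theorem two_le_c (k : ℕ) : 2 ≤ c k :=
  le_trans (by norm_num) (h.scale.sixteen_le_c (by omega) k)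

theorem two_le_a (k : ℕ) : 2 ≤ a k := (h.two_le_c k).trans (h.scale.c_le_a (by omega) k)

theorem z_zero_form (α : EuclideanSpace ℝ (Fin (e + 3))) :
    formHom α (z 0) = α (Fin.last (e + 2)) := by
  rw [h.z_zero]; exact formHom_stdVec α (Fin.last (e + 2))

omit h in
theorem mem_affinePlane_iff {α : EuclideanSpace ℝ (Fin (e + 3))} :
    α ∈ affinePlane (e + 3) ↔ α (Fin.last (e + 2)) = 1 := by
  refine ⟨fun h => h _ (by simp), fun h i hi => ?_⟩
  rwa [show i = Fin.last (e + 2) from Fin.ext (by simp; omega)]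

/-- A form vanishing on the `k`-th basis except at `z k` is decreasing there once its sign is right,
hence also at stage 0. -/
theorem exists_form_decreasingAt (k : ℕ) : ∃ α ∈ affinePlane (e + 3),
    IsDecreasingAt e (fun k => formHom α (z k)) (fun k i => formHom α (y k i)) k := by
  obtain ⟨α, hα0, hy, h1, h2⟩ := exists_form_vanishing (z := z) (y := y) k
  have h3 : formHom α (y k 0) ≠ 0 := fun h3 => hα0 <| h.eq_zero_of_form
    (fun i hi => by rcases i with _ | i; exacts [h3, hy i hi]) h1 h2
  set s := (formHom α (y k 0))⁻¹ with hs
  have hdec : IsDecreasingAt e (fun k => formHom (s • α) (z k))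
      (fun k i => formHom (s • α) (y k i)) k := by
    have h4 : formHom (s • α) (y k 0) = 1 := by
      rw [formHom_smul, hs, inv_mul_cancel₀ h3]
    have h5 : ∀ i < e, formHom (s • α) (y k (i + 1)) = 0 := fun i hi => by
      rw [formHom_smul, hy i hi, mul_zero]
    have h6 : ∀ i ≤ e, 0 ≤ formHom (s • α) (y k i) := fun i hi => by
      rcases i with _ | i
      · rw [h4]; norm_num
      · rw [h5 i hi]
    refine ⟨by simp [formHom_smul, h2], by simp [formHom_smul, h1, h2], ?_, fun i hi => ?_⟩
    · simpa [formHom_smul, h1] using h6 e le_rfl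
    · simpa [h5 i hi] using h6 i hi.le
  have hdec0 := hdec.of_le (h.form_rec _) h.two_le_a h.two_le_c (Nat.zero_le k)
  have hsα : s • α ≠ 0 := smul_ne_zero (inv_ne_zero h3) hα0
  -- At stage 0 the value at `z 0` is the largest; if it were zero, the form would vanish on a
  -- basis. Dividing by it normalises the last coordinate to 1.
  have h7 : formHom (s • α) (z 0) ≠ 0 := fun h7 => hsα <| by
    have h8 : ∀ i ≤ e, formHom (s • α) (y 0 i) = 0 := fun i hi =>
      le_antisymm ((hdec0.antitone (Nat.zero_le _) hi).trans (by simp [h.zero, h7]))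
        (hdec0.y_nonneg hi)
    have h9 : formHom (s • α) (z 1) = 0 :=
      le_antisymm (hdec0.2.2.1.trans (h8 e le_rfl).le) hdec0.z_nonneg
    exact h.eq_zero_of_form h8 h9 (le_antisymm (hdec0.2.1.trans h9.le) hdec0.1)
  have h8 : 0 ≤ formHom (s • α) (z 0) := by
    have := hdec0.y_nonneg (Nat.zero_le e)
    simpa [h.zero] using this
  refine ⟨(formHom (s • α) (z 0))⁻¹ • s • α, ?_, isDecreasingAt_smul (inv_nonneg.2 h8) hdec⟩
  rw [mem_affinePlane_iff, ← h.z_zero_form, formHom_smul, inv_mul_cancel₀ h7]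

theorem exists_form_decreasing : ∃ α ∈ affinePlane (e + 3), ∀ k,
    IsDecreasingAt e (fun k => formHom α (z k)) (fun k i => formHom α (y k i)) k := by
  let K : ℕ → Set (EuclideanSpace ℝ (Fin (e + 3))) := fun k => {α | α ∈ affinePlane (e + 3) ∧
    IsDecreasingAt e (fun k => formHom α (z k)) (fun k i => formHom α (y k i)) k}
  have hclosed : ∀ k, IsClosed (K k) := fun k => by
    simp only [K, IsDecreasingAt, mem_affinePlane_iff, ← h.z_zero_form, Set.ofPred_and,
      Set.ofPred_forall]
    refine (isClosed_eq (continuous_formHom _) continuous_const).inter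
      ((isClosed_le continuous_const (continuous_formHom _)).inter
      ((isClosed_le (continuous_formHom _) (continuous_formHom _)).inter
      ((isClosed_le (continuous_formHom _) (continuous_formHom _)).inter
      (isClosed_iInter fun i => isClosed_iInter fun _ =>
        isClosed_le (continuous_formHom _) (continuous_formHom _)))))
  -- On the initial basis the values lie in [0, 1]. The standard vectors belong to it, except one
  -- that equals `z 1 + z 2`, whence the bound 2.
  have hbdd : Bornology.IsBounded (K 0) := by
    refine (Metric.isBounded_closedBall (x := (0 : EuclideanSpace ℝ (Fin (e + 3))))
      (r := √(∑ _i : Fin (e + 3), 2 ^ 2))).subset fun α hα => ?_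
    obtain ⟨hα1, hα2⟩ := hα
    rw [mem_affinePlane_iff, ← h.z_zero_form] at hα1
    have h1 : ∀ i ≤ e, formHom α (y 0 i) ≤ 1 := fun i hi =>
      (hα2.antitone (Nat.zero_le _) hi).trans (by simp [h.zero, hα1])
    have h2 : formHom α (z 1) ≤ 1 := hα2.2.2.1.trans (h1 e le_rfl)
    have h3 : formHom α (z 2) ≤ 1 := hα2.2.1.trans h2
    have h4 : 0 ≤ formHom α (z 1) := hα2.z_nonneg
    have h5 : 0 ≤ formHom α (z 2) := hα2.1
    have h6 : ∀ i < e + 3, |formHom α (stdVec _ i)| ≤ 2 := fun i hi => by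
      rw [abs_le]
      rcases i with _ | _ | i
      · rw [h.z_one] at h2 h4
        constructor <;> linarith
      · have h7 : formHom α (stdVec (e + 3) (0 + 1)) = formHom α (z 2) + formHom α (z 1) := by
          rw [← map_add, h.z_one, h.z_two, sub_add_cancel]
        rw [h7]
        constructor <;> linarith
      · rcases Nat.lt_or_ge i e with hie | hie
        · rw [← h.y_zero i hie]
          have h8 := h1 (i + 1) hie
          have h9 := hα2.y_nonneg (i := i + 1) hie
          constructor <;> linarith
        · obtain rfl : i = e := by omega
          rw [← h.z_zero, hα1]
          norm_num
    rw [mem_closedBall_zero_iff, EuclideanSpace.norm_eq]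
    gcongr with i
    rw [← formHom_stdVec]
    exact h6 i i.2
  have hcomp : IsCompact (K 0) := Metric.isCompact_of_isClosed_isBounded (hclosed 0) hbdd
  obtain ⟨α, hα⟩ := IsCompact.nonempty_iInter_of_sequence_nonempty_isCompact_isClosed K
    (fun k α hα => ⟨hα.1, IsDecreasingAt.of_succ (h.form_rec α) h.two_le_a h.two_le_c hα.2⟩)
    (fun k => h.exists_form_decreasingAt k) hcomp hclosed
  rw [Set.mem_iInter] at hα
  exact ⟨α, (hα 0).1, fun k => (hα k).2⟩

end IsLatticeSystem

/-! ### Sizes and directions of the basis vectors -/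

theorem truncate_smul {d : ℕ} (r : ℝ) (x : EuclideanSpace ℝ (Fin d)) :
    truncate (r • x) = r • truncate x := rfl

theorem truncate_sub {d : ℕ} (x y : EuclideanSpace ℝ (Fin d)) :
    truncate (x - y) = truncate x - truncate y := rfl

theorem inner_eq_truncate {e : ℕ} (x y : EuclideanSpace ℝ (Fin (e + 3))) :
    inner ℝ x y = inner ℝ (truncate x) (truncate y) +
      x (Fin.last (e + 2)) * y (Fin.last (e + 2)) := by
  rw [PiLp.inner_apply, PiLp.inner_apply, Fin.sum_univ_castSucc]
  simp only [RCLike.inner_apply, conj_trivial]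
  rw [mul_comm (y (Fin.last (e + 2)))]
  rfl

theorem norm_sq_eq_truncate {e : ℕ} (x : EuclideanSpace ℝ (Fin (e + 3))) :
    ‖x‖ ^ 2 = ‖truncate x‖ ^ 2 + x (Fin.last (e + 2)) ^ 2 := by
  rw [← real_inner_self_eq_norm_sq, ← real_inner_self_eq_norm_sq, inner_eq_truncate, sq]

theorem norm_truncate_le {e : ℕ} (x : EuclideanSpace ℝ (Fin (e + 3))) : ‖truncate x‖ ≤ ‖x‖ := by
  refine (sq_le_sq₀ (norm_nonneg _) (norm_nonneg _)).1 ?_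
  rw [norm_sq_eq_truncate x]
  linarith [sq_nonneg (x (Fin.last (e + 2)))]

theorem abs_apply_le_norm_truncate {e : ℕ} (x : EuclideanSpace ℝ (Fin (e + 3))) {i : Fin (e + 3)}
    (hi : (i : ℕ) < e + 2) : |x i| ≤ ‖truncate x‖ :=
  PiLp.norm_apply_le (truncate x) (⟨i, hi⟩ : Fin (e + 2))

theorem intVec_stdVec {d : ℕ} (j : Fin d) :
    intVec (stdVec d j) = EuclideanSpace.single j (1 : ℝ) := by
  ext i
  simp [intVec_apply, stdVec, Fin.ext_iff]

theorem intVec_stdVec_apply {d i : ℕ} (j : Fin d) :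
    intVec (stdVec d i) j = if (j : ℕ) = i then 1 else 0 := by
  simp [intVec_apply, stdVec]

theorem norm_intVec_stdVec {d i : ℕ} (hi : i < d) : ‖intVec (stdVec d i)‖ = 1 := by
  have := intVec_stdVec (⟨i, hi⟩ : Fin d)
  simp only at this
  rw [this]
  simp

/-- The perturbation changes the inner product by at most 1/4 + 1/4 + 1/36 < 1. -/
theorem inner_neg_of_near {V : Type*} [NormedAddCommGroup V] [InnerProductSpace ℝ V]
    {u v f g : V} (hf : ‖f‖ ≤ 3 / 2) (hg : ‖g‖ ≤ 3 / 2) (hu : ‖u - f‖ ≤ 1 / 6)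
    (hv : ‖v - g‖ ≤ 1 / 6) (hfg : inner ℝ f g = (-1 : ℝ)) : inner ℝ u v < (0 : ℝ) := by
  have h1 : inner ℝ u v = inner ℝ f g + inner ℝ (u - f) g + inner ℝ f (v - g) +
      (inner ℝ (u - f) (v - g) : ℝ) := by
    simp only [inner_sub_left, inner_sub_right]; ring
  have h2 : inner ℝ (u - f) g ≤ 1 / 6 * (3 / 2 : ℝ) :=
    (real_inner_le_norm _ _).trans (by gcongr)
  have h3 : inner ℝ f (v - g) ≤ 3 / 2 * (1 / 6 : ℝ) :=
    (real_inner_le_norm _ _).trans (by gcongr)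
  have h4 : inner ℝ (u - f) (v - g) ≤ 1 / 6 * (1 / 6 : ℝ) :=
    (real_inner_le_norm _ _).trans (by gcongr)
  linarith

namespace IsLatticeSystem

variable {e : ℕ} {X a c : ℕ → ℕ} {z : ℕ → Fin (e + 3) → ℤ} {y : ℕ → ℕ → Fin (e + 3) → ℤ}
  (h : IsLatticeSystem e X a c z y)

include h

theorem intVec_rec : ChainRec e a c (fun k => intVec (z k)) (fun k i => intVec (y k i)) :=
  h.toChainRec.map (intVecHom _)

theorem X_pos (k : ℕ) : (0 : ℝ) < X k := by exact_mod_cast h.scale.pos (by omega) k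

theorem X_gap (k : ℕ) : 16 * ((e : ℝ) + 3) * 2 ^ k * X (k + 2) ≤ X (k + 3) := by
  exact_mod_cast h.scale.gap k

theorem X_mono {j k : ℕ} (hjk : j ≤ k) : (X j : ℝ) ≤ X k := by
  exact_mod_cast h.scale.monotone (by omega) hjk

theorem y_normalized_succ (k i : ℕ) (hi : i < e) :
    (X (k + 3) : ℝ)⁻¹ • intVec (y (k + 1) (i + 1)) =
      (X (k + 2) : ℝ)⁻¹ • intVec (y k (i + 1)) - (X (k + 3) : ℝ)⁻¹ • intVec (y k i) := by
  have h1 : (X (k + 3) : ℝ) = c k * X (k + 2) := by exact_mod_cast h.scale.mul_c k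
  have h2 := h.X_pos (k + 2)
  have h3 := h.X_pos (k + 3)
  have h4 : (c k : ℝ) ≠ 0 := by have := h.two_le_c k; positivity
  rw [h.intVec_rec.succ k i hi, smul_sub, ← Nat.cast_smul_eq_nsmul ℝ, smul_smul]
  congr 2
  rw [h1]
  field_simp

theorem z_normalized_succ (k : ℕ) :
    (X (k + 3) : ℝ)⁻¹ • intVec (z (k + 3)) =
      (X (k + 1) : ℝ)⁻¹ • intVec (z (k + 1)) - (X (k + 3) : ℝ)⁻¹ • intVec (y k e) := by
  have h1 : (X (k + 3) : ℝ) = a k * X (k + 1) := by exact_mod_cast h.scale.mul_a k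
  have h2 := h.X_pos (k + 1)
  have h4 : (a k : ℝ) ≠ 0 := by have := h.two_le_a k; positivity
  have := h.intVec_rec.last k
  rw [this, smul_sub, ← Nat.cast_smul_eq_nsmul ℝ, smul_smul]
  congr 2
  rw [h1]
  field_simp

omit h in
/-- The direction that the normalised `z k` approximate. -/
noncomputable def frame (z : ℕ → Fin (e + 3) → ℤ) (k : ℕ) : EuclideanSpace ℝ (Fin (e + 3)) :=
  if Even k then intVec (z 2) else intVec (z 1)

omit h in
theorem frame_add_two (k : ℕ) : frame z (k + 2) = frame z k := by
  simp [frame, Nat.even_add]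

theorem intVec_z_two : intVec (z 2) = intVec (stdVec (e + 3) 1) - intVec (stdVec (e + 3) 0) := by
  rw [h.z_two]; exact map_sub (intVecHom _) _ _

theorem inner_z_one_z_two : inner ℝ (intVec (z 1)) (intVec (z 2)) = (-1 : ℝ) := by
  have h0 := intVec_stdVec (0 : Fin (e + 3))
  have h1 := intVec_stdVec (1 : Fin (e + 3))
  simp only [Fin.val_zero, Fin.val_one] at h0 h1
  rw [h.intVec_z_two, h.z_one, inner_sub_right, h0, h1]
  simp [EuclideanSpace.inner_single_left]

theorem norm_z_one : ‖intVec (z 1)‖ = 1 := by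
  rw [h.z_one]; exact norm_intVec_stdVec (by omega)

theorem norm_z_two_sq : ‖intVec (z 2)‖ ^ 2 = 2 := by
  have h1 := h.inner_z_one_z_two
  have h2 : intVec (z 2) + intVec (z 1) = intVec (stdVec (e + 3) 1) := by
    rw [h.intVec_z_two, h.z_one, sub_add_cancel]
  have h3 := norm_add_sq_real (intVec (z 2)) (intVec (z 1))
  rw [h2, norm_intVec_stdVec (by omega), h.norm_z_one, real_inner_comm, h1] at h3
  linarith

theorem norm_z_two_le : ‖intVec (z 2)‖ ≤ 3 / 2 := by
  nlinarith [h.norm_z_two_sq, norm_nonneg (intVec (z 2))]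

theorem norm_frame_le (k : ℕ) : ‖frame z k‖ ≤ 3 / 2 := by
  unfold frame
  split_ifs
  · exact h.norm_z_two_le
  · rw [h.norm_z_one]; norm_num

/-- After normalisation, one step of the recursion subtracts a vector of size at most 2 `X (k + 2)`
/ `X (k + 3)`. The growth of the scales makes these errors geometric, and the four bounds support
each other in the induction. -/
theorem near_aux (k : ℕ) :
    (∀ i < e, ‖(X (k + 2) : ℝ)⁻¹ • intVec (y k (i + 1)) - intVec (stdVec _ (i + 2))‖ ≤
      (1 - (1 / 2) ^ k) / (2 * (e + 3))) ∧
    ‖(X (k + 1) : ℝ)⁻¹ • intVec (z (k + 1)) - frame z (k + 1)‖ ≤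
      (1 - (1 / 2) ^ k) / (2 * (e + 3)) ∧
    ‖(X (k + 2) : ℝ)⁻¹ • intVec (z (k + 2)) - frame z (k + 2)‖ ≤
      (1 - (1 / 2) ^ k) / (2 * (e + 3)) ∧
    ∀ i ≤ e, ‖(X (k + 3) : ℝ)⁻¹ • intVec (y k i)‖ ≤ (1 / 2) ^ k / (8 * (e + 3)) := by
  have hsmall : ∀ (k : ℕ) (v : EuclideanSpace ℝ (Fin (e + 3))), ‖v‖ ≤ 2 * X (k + 2) →
      ‖(X (k + 3) : ℝ)⁻¹ • v‖ ≤ (1 / 2) ^ k / (8 * (e + 3)) := fun k v hv => by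
    have h3 := h.X_pos (k + 3)
    have hg := h.X_gap k
    rw [norm_smul, norm_inv, Real.norm_of_nonneg h3.le, inv_mul_le_iff₀ h3, one_div_pow,
      ← mul_div_assoc, le_div_iff₀ (by positivity), mul_one_div, le_div_iff₀ (by positivity)]
    calc ‖v‖ * (8 * (e + 3)) * 2 ^ k ≤ 2 * X (k + 2) * (8 * (e + 3)) * 2 ^ k := by gcongr
      _ = 16 * ((e : ℝ) + 3) * 2 ^ k * X (k + 2) := by ring
      _ ≤ _ := hg
  have hbd : ∀ (m : ℕ) (v f : EuclideanSpace ℝ (Fin (e + 3))), ‖f‖ ≤ 3 / 2 →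
      ‖(X m : ℝ)⁻¹ • v - f‖ ≤ 1 / 2 → ‖v‖ ≤ 2 * X m := fun m v f hf hv => by
    have hm := h.X_pos m
    have h1 : ‖(X m : ℝ)⁻¹ • v‖ ≤ 2 := by
      have := norm_le_norm_add_norm_sub' ((X m : ℝ)⁻¹ • v) f
      linarith
    rw [norm_smul, norm_inv, Real.norm_of_nonneg hm.le, inv_mul_le_iff₀ hm] at h1
    linarith
  have hη : ∀ k : ℕ, (1 - (1 / 2 : ℝ) ^ k) / (2 * (e + 3)) ≤ 1 / 2 := fun k => by
    rw [div_le_iff₀ (by positivity)]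
    have : (0 : ℝ) < (1 / 2) ^ k := by positivity
    have : (0 : ℝ) ≤ e := by positivity
    linarith
  have hstep : ∀ k : ℕ, (1 - (1 / 2 : ℝ) ^ k) / (2 * (e + 3)) + (1 / 2) ^ k / (8 * (e + 3)) ≤
      (1 - (1 / 2) ^ (k + 1)) / (2 * (e + 3)) := fun k => by
    have h1 : (0 : ℝ) < (1 / 2) ^ k := by positivity
    rw [pow_succ, ← sub_nonneg]
    have : (1 - (1 / 2 : ℝ) ^ k * (1 / 2)) / (2 * (e + 3)) -
        ((1 - (1 / 2 : ℝ) ^ k) / (2 * (e + 3)) + (1 / 2) ^ k / (8 * (e + 3))) =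
        (1 / 2) ^ k / (8 * (e + 3)) := by field_simp; ring
    rw [this]; positivity
  induction k with
  | zero =>
    refine ⟨fun i hi => ?_, ?_, ?_, fun i hi => hsmall _ _ ?_⟩
    · simp [h.y_zero i hi, h.scale.two]
    · simp [frame, h.scale.one]
    · simp [frame, h.scale.two]
    · rw [h.scale.two]
      rcases i with _ | i
      · rw [h.zero, h.z_zero, norm_intVec_stdVec (by omega)]; norm_num
      · rw [h.y_zero i hi, norm_intVec_stdVec (by omega)]; norm_num
  | succ k ih =>
    obtain ⟨h1, h2, h3, h4⟩ := ih
    have hy : ∀ i < e, ‖(X (k + 1 + 2) : ℝ)⁻¹ • intVec (y (k + 1) (i + 1)) -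
        intVec (stdVec _ (i + 2))‖ ≤ (1 - (1 / 2) ^ (k + 1)) / (2 * (e + 3)) := fun i hi => by
      show ‖(X (k + 3) : ℝ)⁻¹ • intVec (y (k + 1) (i + 1)) - _‖ ≤ _
      rw [h.y_normalized_succ k i hi, sub_right_comm]
      exact (norm_sub_le _ _).trans ((add_le_add (h1 i hi) (h4 i hi.le)).trans (hstep k))
    refine ⟨hy, ?_, ?_, fun i hi => hsmall _ _ ?_⟩
    · refine h3.trans (le_trans ?_ (hstep k))
      have : (0 : ℝ) ≤ (1 / 2) ^ k / (8 * (e + 3)) := by positivity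
      linarith
    · show ‖(X (k + 3) : ℝ)⁻¹ • intVec (z (k + 3)) - frame z (k + 1 + 2)‖ ≤ _
      rw [h.z_normalized_succ, frame_add_two, sub_right_comm]
      exact (norm_sub_le _ _).trans ((add_le_add h2 (h4 e le_rfl)).trans (hstep k))
    · rcases i with _ | i
      · rw [h.zero]
        refine (hbd (k + 1) _ _ (h.norm_frame_le _) (h2.trans (hη k))).trans ?_
        have := h.X_mono (show k + 1 ≤ k + 1 + 2 by omega)
        linarith
      · exact hbd _ _ _ ((norm_intVec_stdVec (by omega)).le.trans (by norm_num))
          ((hy i hi).trans (hη _))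

omit h in
theorem near_bound_le (k : ℕ) :
    (1 - (1 / 2 : ℝ) ^ k) / (2 * (e + 3)) ≤ 1 / (2 * (e + 3)) := by
  have : (0 : ℝ) < (1 / 2) ^ k := by positivity
  gcongr
  linarith

theorem y_near (k i : ℕ) (hi : i < e) :
    ‖(X (k + 2) : ℝ)⁻¹ • intVec (y k (i + 1)) - intVec (stdVec _ (i + 2))‖ ≤
      1 / (2 * (e + 3)) := ((h.near_aux k).1 i hi).trans (near_bound_le k)

theorem z_near (k : ℕ) (hk : 1 ≤ k) :
    ‖(X k : ℝ)⁻¹ • intVec (z k) - frame z k‖ ≤ 1 / (2 * (e + 3)) := by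
  obtain ⟨k, rfl⟩ := Nat.exists_eq_add_of_le' hk
  exact (h.near_aux k).2.1.trans (near_bound_le k)

theorem z_near' (k : ℕ) (hk : 1 ≤ k) : ‖(X k : ℝ)⁻¹ • intVec (z k) - frame z k‖ ≤ 1 / 6 := by
  refine (h.z_near k hk).trans ?_
  have : (0 : ℝ) ≤ e := by positivity
  exact one_div_le_one_div_of_le (by norm_num) (by linarith)

theorem z_step (k : ℕ) : ‖(X (k + 3) : ℝ)⁻¹ • intVec (z (k + 3)) -
    (X (k + 1) : ℝ)⁻¹ • intVec (z (k + 1))‖ ≤ (1 / 2) ^ k := by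
  rw [h.z_normalized_succ, sub_sub_cancel_left, norm_neg]
  refine ((h.near_aux k).2.2.2 e le_rfl).trans (div_le_self (by positivity) ?_)
  have : (0 : ℝ) ≤ e := by positivity
  linarith

theorem norm_z_le (k : ℕ) (hk : 1 ≤ k) : ‖intVec (z k)‖ ≤ 2 * X k := by
  have hm := h.X_pos k
  have h1 : ‖(X k : ℝ)⁻¹ • intVec (z k)‖ ≤ 2 := by
    have := norm_le_norm_add_norm_sub' ((X k : ℝ)⁻¹ • intVec (z k)) (frame z k)
    linarith [h.z_near' k hk, h.norm_frame_le k]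
  rw [norm_smul, norm_inv, Real.norm_of_nonneg hm.le, inv_mul_le_iff₀ hm] at h1
  linarith

theorem z_one_last : intVec (z 1) (Fin.last (e + 2)) = 0 := by
  rw [h.z_one, intVec_stdVec_apply]; simp

theorem z_two_last : intVec (z 2) (Fin.last (e + 2)) = 0 := by
  rw [h.intVec_z_two, PiLp.sub_apply, intVec_stdVec_apply, intVec_stdVec_apply]; simp

theorem norm_truncate_z_one : ‖truncate (intVec (z 1))‖ = 1 := by
  have := norm_sq_eq_truncate (intVec (z 1))
  rw [h.norm_z_one, h.z_one_last] at this
  nlinarith [norm_nonneg (truncate (intVec (z 1)))]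

theorem norm_truncate_z_two_sq : ‖truncate (intVec (z 2))‖ ^ 2 = 2 := by
  have := norm_sq_eq_truncate (intVec (z 2))
  rw [h.norm_z_two_sq, h.z_two_last] at this
  linarith

theorem one_le_norm_truncate_frame (k : ℕ) : 1 ≤ ‖truncate (frame z k)‖ := by
  unfold frame
  split_ifs
  · nlinarith [h.norm_truncate_z_two_sq, norm_nonneg (truncate (intVec (z 2)))]
  · exact h.norm_truncate_z_one.ge

theorem le_norm_truncate_z (k : ℕ) (hk : 1 ≤ k) :
    5 / 6 * (X k : ℝ) ≤ ‖truncate (intVec (z k))‖ := by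
  have hm := h.X_pos k
  have h1 : 5 / 6 ≤ ‖truncate ((X k : ℝ)⁻¹ • intVec (z k))‖ := by
    have h2 := norm_le_norm_add_norm_sub (truncate ((X k : ℝ)⁻¹ • intVec (z k)))
      (truncate (frame z k))
    rw [← truncate_sub] at h2
    linarith [h.z_near' k hk, h.one_le_norm_truncate_frame k,
      norm_truncate_le ((X k : ℝ)⁻¹ • intVec (z k) - frame z k)]
  rw [truncate_smul, norm_smul, norm_inv, Real.norm_of_nonneg hm.le, inv_mul_eq_div,
    le_div_iff₀ hm] at h1
  exact h1

theorem norm_truncate_z_lt (k : ℕ) (hk : 1 ≤ k) :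
    ‖truncate (intVec (z k))‖ < ‖truncate (intVec (z (k + 1)))‖ := by
  rcases k with _ | _ | k
  · omega
  · rw [h.norm_truncate_z_one]
    nlinarith [h.norm_truncate_z_two_sq, norm_nonneg (truncate (intVec (z 2)))]
  · have h1 := (norm_truncate_le _).trans (h.norm_z_le (k + 2) (by omega))
    have h2 := h.le_norm_truncate_z (k + 3) (by omega)
    have h3 := h.X_gap k
    have h4 := h.X_pos (k + 2)
    have h5 : (16 : ℝ) * X (k + 2) ≤ 16 * (e + 3) * 2 ^ k * X (k + 2) := by
      have : (1 : ℝ) ≤ 2 ^ k := one_le_pow₀ (by norm_num)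
      have : (1 : ℝ) ≤ (e + 3) * 2 ^ k := by nlinarith [(Nat.cast_nonneg e : (0 : ℝ) ≤ e)]
      nlinarith
    show ‖truncate (intVec (z (k + 2)))‖ < ‖truncate (intVec (z (k + 3)))‖
    linarith

theorem inner_truncate_frame (k : ℕ) :
    inner ℝ (truncate (frame z k)) (truncate (frame z (k + 1))) = (-1 : ℝ) := by
  have h1 := inner_eq_truncate (intVec (z 1)) (intVec (z 2))
  rw [h.inner_z_one_z_two, h.z_one_last, zero_mul, add_zero] at h1
  rcases Nat.even_or_odd k with hk | hk
  · rw [real_inner_comm]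
    simp [frame, hk, Nat.even_add_one, h1]
  · rw [← Nat.not_even_iff_odd] at hk
    simp [frame, hk, Nat.even_add_one, h1]

theorem inner_truncate_z_neg (k : ℕ) (hk : 1 ≤ k) :
    inner ℝ (truncate (intVec (z k))) (truncate (intVec (z (k + 1)))) < (0 : ℝ) := by
  have h1 : inner ℝ ((X k : ℝ)⁻¹ • truncate (intVec (z k)))
      ((X (k + 1) : ℝ)⁻¹ • truncate (intVec (z (k + 1)))) < (0 : ℝ) := by
    refine inner_neg_of_near ((norm_truncate_le _).trans (h.norm_frame_le k))
      ((norm_truncate_le _).trans (h.norm_frame_le (k + 1))) ?_ ?_ (h.inner_truncate_frame k)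
    · rw [← truncate_smul, ← truncate_sub]
      exact (norm_truncate_le _).trans (h.z_near' _ hk)
    · rw [← truncate_smul, ← truncate_sub]
      exact (norm_truncate_le _).trans (h.z_near' _ (by omega))
  rw [real_inner_smul_left, real_inner_smul_right] at h1
  have h2 := inv_pos.2 (h.X_pos k)
  have h3 := inv_pos.2 (h.X_pos (k + 1))
  by_contra! h4
  exact absurd h1 (not_lt.2 (mul_nonneg h2.le (mul_nonneg h3.le h4)))

/-- The coordinates of the combination are p - q, q and the s_i, none of them the dropped one; p
costs two norms, hence the factor e + 3. -/
theorem frame_coeff_le (p q : ℝ) (s : ℕ → ℝ) :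
    |p| + |q| + ∑ i ∈ Finset.range e, |s i| ≤ (e + 3) * ‖truncate (p • intVec (z 1) +
      q • intVec (z 2) + ∑ i ∈ Finset.range e, s i • intVec (stdVec (e + 3) (i + 2)))‖ := by
  set x := p • intVec (z 1) + q • intVec (z 2) +
    ∑ i ∈ Finset.range e, s i • intVec (stdVec (e + 3) (i + 2)) with hx
  have hxj : ∀ j : Fin (e + 3), x j = p * (if (j : ℕ) = 0 then 1 else 0) +
      q * ((if (j : ℕ) = 1 then 1 else 0) - (if (j : ℕ) = 0 then 1 else 0)) +
      ∑ i ∈ Finset.range e, s i * (if (j : ℕ) = i + 2 then 1 else 0) := fun j => by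
    simp only [hx, h.z_one, h.intVec_z_two, PiLp.add_apply, PiLp.smul_apply, PiLp.sub_apply,
      WithLp.ofLp_sum, Finset.sum_apply, intVec_stdVec_apply, smul_eq_mul]
  have h0 : |p - q| ≤ ‖truncate x‖ := by
    have := abs_apply_le_norm_truncate x (i := ⟨0, by omega⟩) (by simp)
    rw [hxj] at this
    simpa [sub_eq_add_neg] using this
  have h1 : |q| ≤ ‖truncate x‖ := by
    have := abs_apply_le_norm_truncate x (i := ⟨1, by omega⟩) (by simp)
    rw [hxj] at this
    simpa using this
  have h2 : ∀ i ∈ Finset.range e, |s i| ≤ ‖truncate x‖ := fun i hi => by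
    have hi' := Finset.mem_range.1 hi
    have := abs_apply_le_norm_truncate x (i := ⟨i + 2, by omega⟩) (by simp; omega)
    rw [hxj] at this
    simpa [hi'] using this
  have h3 : |p| ≤ |p - q| + |q| := by
    have := abs_add_le (p - q) q
    rwa [sub_add_cancel] at this
  have h4 := Finset.sum_le_sum h2
  rw [Finset.sum_const, Finset.card_range, nsmul_eq_mul] at h4
  linarith

theorem coeff_le_normalized (k : ℕ) (p q : ℝ) (s : ℕ → ℝ) :
    |p| + |q| + ∑ i ∈ Finset.range e, |s i| ≤ 2 * (e + 3) *
      ‖truncate (p • ((X (k + 1) : ℝ)⁻¹ • intVec (z (k + 1))) +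
        q • ((X (k + 2) : ℝ)⁻¹ • intVec (z (k + 2))) +
        ∑ i ∈ Finset.range e, s i • ((X (k + 2) : ℝ)⁻¹ • intVec (y k (i + 1))))‖ := by
  set x := p • ((X (k + 1) : ℝ)⁻¹ • intVec (z (k + 1))) +
        q • ((X (k + 2) : ℝ)⁻¹ • intVec (z (k + 2))) +
        ∑ i ∈ Finset.range e, s i • ((X (k + 2) : ℝ)⁻¹ • intVec (y k (i + 1))) with hx
  set x₀ := p • frame z (k + 1) + q • frame z (k + 2) +
    ∑ i ∈ Finset.range e, s i • intVec (stdVec (e + 3) (i + 2)) with hx₀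
  have h1 : |p| + |q| + ∑ i ∈ Finset.range e, |s i| ≤ (e + 3) * ‖truncate x₀‖ := by
    rcases Nat.even_or_odd k with hk | hk
    · have := h.frame_coeff_le p q s
      simpa [hx₀, frame, hk, Nat.even_add_one, Nat.even_add] using this
    · rw [← Nat.not_even_iff_odd] at hk
      have := h.frame_coeff_le q p s
      rw [add_comm |q|, add_comm (q • _)] at this
      simpa [hx₀, frame, hk, Nat.even_add_one, Nat.even_add] using this
  have h2 : ‖x - x₀‖ ≤ (|p| + |q| + ∑ i ∈ Finset.range e, |s i|) * (1 / (2 * (e + 3))) := by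
    have : x - x₀ = p • ((X (k + 1) : ℝ)⁻¹ • intVec (z (k + 1)) - frame z (k + 1)) +
        q • ((X (k + 2) : ℝ)⁻¹ • intVec (z (k + 2)) - frame z (k + 2)) +
        ∑ i ∈ Finset.range e, s i • ((X (k + 2) : ℝ)⁻¹ • intVec (y k (i + 1)) -
          intVec (stdVec (e + 3) (i + 2))) := by
      simp only [hx, hx₀, smul_sub, Finset.sum_sub_distrib]
      abel
    rw [this, add_mul, add_mul, Finset.sum_mul]
    refine (norm_add₃_le).trans (add_le_add (add_le_add ?_ ?_) ((norm_sum_le _ _).trans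
      (Finset.sum_le_sum fun i hi => ?_))) <;> rw [norm_smul, Real.norm_eq_abs] <;> gcongr
    · exact h.z_near _ (by omega)
    · exact h.z_near _ (by omega)
    · exact h.y_near _ _ (Finset.mem_range.1 hi)
  have h3 : ‖truncate x₀‖ ≤ ‖truncate x‖ + ‖x - x₀‖ := by
    have h4 := norm_le_norm_add_norm_sub (truncate x) (truncate x₀)
    rw [← truncate_sub] at h4
    exact h4.trans (by gcongr; exact norm_truncate_le _)
  set S := |p| + |q| + ∑ i ∈ Finset.range e, |s i|
  -- The closeness 1/(2(e + 3)) is what makes the perturbation cost only S/2, which the left-hand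
  -- side absorbs.
  have h5 : ((e : ℝ) + 3) * (S * (1 / (2 * (e + 3)))) = S / 2 := by field_simp
  have h6 : S ≤ (e + 3) * (‖truncate x‖ + S * (1 / (2 * (e + 3)))) :=
    h1.trans (by gcongr; exact h3.trans (by gcongr))
  linarith

/-- The coefficients with respect to the `k`-th basis without `z k` are controlled. -/
theorem coeff_le (k : ℕ) (p q : ℤ) (r : ℕ → ℤ) :
    |(p : ℝ)| * X (k + 1) + |(q : ℝ)| * X (k + 2) +
      ∑ i ∈ Finset.range e, |(r i : ℝ)| * X (k + 2) ≤ 2 * (e + 3) *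
      ‖truncate (intVec (p • z (k + 1) + q • z (k + 2) +
        ∑ i ∈ Finset.range e, r i • y k (i + 1)))‖ := by
  have h1 := h.X_pos (k + 1)
  have h2 := h.X_pos (k + 2)
  have := h.coeff_le_normalized k (p * X (k + 1)) (q * X (k + 2)) (fun i => r i * X (k + 2))
  simp only [abs_mul, abs_of_pos h1, abs_of_pos h2, smul_smul, mul_assoc, mul_inv_cancel₀ h1.ne',
    mul_inv_cancel₀ h2.ne', mul_one] at this
  rw [mul_assoc]
  convert this using 5
  rw [← intVecHom_apply]
  simp only [map_add, map_sum, map_zsmul, intVecHom_apply, Int.cast_smul_eq_zsmul]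

end IsLatticeSystem

/-! ### Determination of the best approximation vectors -/

theorem truncate_intVec_smul {d : ℕ} (m : ℤ) (v : Fin d → ℤ) :
    truncate (intVec (m • v)) = (m : ℝ) • truncate (intVec v) := by
  ext i; simp [truncate, intVec_apply]

theorem truncate_intVec_add {d : ℕ} (v w : Fin d → ℤ) :
    truncate (intVec (v + w)) = truncate (intVec v) + truncate (intVec w) := by
  ext i; simp [truncate, intVec_apply]

theorem truncate_intVec_neg {d : ℕ} (v : Fin d → ℤ) :
    truncate (intVec (-v)) = -truncate (intVec v) := by
  ext i; simp [truncate, intVec_apply]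

namespace IsLatticeSystem

variable {e : ℕ} {X a c : ℕ → ℕ} {z : ℕ → Fin (e + 3) → ℤ} {y : ℕ → ℕ → Fin (e + 3) → ℤ}
  (h : IsLatticeSystem e X a c z y) {α : EuclideanSpace ℝ (Fin (e + 3))}
  (hα : α ∈ affinePlane (e + 3))
  (hd : ∀ k, IsDecreasingAt e (fun k => formHom α (z k)) (fun k i => formHom α (y k i)) k)

include h hα hd

omit hd in
theorem form_z_zero : formHom α (z 0) = 1 := by
  rw [h.z_zero_form]; exact mem_affinePlane_iff.1 hα

theorem form_z_pos (k : ℕ) : 0 < formHom α (z k) :=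
  z_pos (h.form_rec α) hd (by rw [h.form_z_zero hα]; norm_num) k

omit hα in
theorem form_y_le (k i : ℕ) (hi : i < e) :
    formHom α (y k (i + 1)) ≤ 2 * formHom α (z k) / c k := by
  have hc : (2 : ℝ) ≤ c k := by exact_mod_cast h.two_le_c k
  have h1 := mul_le_y (h.form_rec α) hd (k := k) (show 0 < e by omega)
  have h2 : formHom α (y k (i + 1)) ≤ formHom α (y k (0 + 1)) :=
    (hd k).antitone (by omega) (by omega)
  have h3 : 0 ≤ formHom α (y k (i + 1)) := (hd k).y_nonneg hi
  rw [h.zero] at h1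
  rw [le_div_iff₀ (by linarith)]
  nlinarith

theorem form_z_succ_le (k : ℕ) : formHom α (z (k + 1)) ≤ 2 * formHom α (z k) / a k := by
  have ha : (2 : ℝ) ≤ a k := by exact_mod_cast h.two_le_a k
  have h1 : (a k - 1) * formHom α (z (k + 1)) ≤ formHom α (y k e) :=
    mul_le_y_last (h.form_rec α) hd k
  have h2 : formHom α (y k e) ≤ formHom α (y k 0) := (hd k).antitone (Nat.zero_le _) le_rfl
  have h3 := h.form_z_pos hα hd (k + 1)
  rw [h.zero] at h2
  rw [le_div_iff₀ (by linarith)]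
  nlinarith

theorem form_z_succ_lt (k : ℕ) : formHom α (z (k + 1)) < formHom α (z k) := by
  have ha : (16 : ℝ) ≤ a k := by
    exact_mod_cast (h.scale.sixteen_le_c (by omega) k).trans (h.scale.c_le_a (by omega) k)
  have h1 := h.form_z_succ_le hα hd k
  have h3 := h.form_z_pos hα hd (k + 1)
  rw [le_div_iff₀ (by linarith)] at h1
  nlinarith

theorem abs_form_le (k : ℕ) (p q : ℤ) (r : ℕ → ℤ) :
    |formHom α (p • z (k + 1) + q • z (k + 2) + ∑ i ∈ Finset.range e, r i • y k (i + 1))| ≤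
      (|(p : ℝ)| * X (k + 1) + |(q : ℝ)| * X (k + 2) +
        ∑ i ∈ Finset.range e, |(r i : ℝ)| * X (k + 2)) *
        (2 * formHom α (z k) / (c k * X (k + 2))) := by
  have hc : (2 : ℝ) ≤ c k := by exact_mod_cast h.two_le_c k
  have ha : (2 : ℝ) ≤ a k := by exact_mod_cast h.two_le_a k
  have hca : (c k : ℝ) ≤ a k := by exact_mod_cast h.scale.c_le_a (by omega) k
  have hX1 := h.X_pos (k + 1)
  have hX2 := h.X_pos (k + 2)
  have hz := h.form_z_pos hα hd k
  have hac : (c k : ℝ) * X (k + 2) = a k * X (k + 1) := by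
    exact_mod_cast (h.scale.mul_c k).symm.trans (h.scale.mul_a k)
  -- Both `c k * X (k + 2)` and `a k * X (k + 1)` equal `X (k + 3)`, so the same B bounds value per
  -- unit of size for every basis vector other than `z k`.
  set B := 2 * formHom α (z k) / (c k * X (k + 2)) with hB
  have hB2 : X (k + 2) * B = 2 * formHom α (z k) / c k := by rw [hB]; field_simp
  have hB1 : X (k + 1) * B = 2 * formHom α (z k) / a k := by rw [hB, hac]; field_simp
  have hz1 : formHom α (z (k + 1)) ≤ X (k + 1) * B := by
    rw [hB1]; exact h.form_z_succ_le hα hd k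
  have hz2 : formHom α (z (k + 2)) ≤ X (k + 2) * B := by
    rw [hB2]
    exact (h.form_z_succ_lt hα hd (k + 1)).le.trans
      ((h.form_z_succ_le hα hd k).trans (by gcongr))
  rw [map_add, map_add, map_sum, map_zsmul, map_zsmul, zsmul_eq_mul, zsmul_eq_mul, add_mul, add_mul,
    Finset.sum_mul]
  refine (abs_add_three _ _ _).trans (add_le_add (add_le_add ?_ ?_)
    ((Finset.abs_sum_le_sum_abs _ _).trans (Finset.sum_le_sum fun i hi => ?_)))
  · rw [abs_mul, abs_of_pos (h.form_z_pos hα hd _), mul_assoc]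
    gcongr
  · rw [abs_mul, abs_of_pos (h.form_z_pos hα hd _), mul_assoc]
    gcongr
  · have hi' := Finset.mem_range.1 hi
    rw [map_zsmul, zsmul_eq_mul, abs_mul, abs_of_nonneg ((hd k).y_nonneg hi'), mul_assoc, hB2]
    gcongr
    exact h.form_y_le hd k i hi'

omit hα hd in
-- The case k = 0 is excluded because `X 1 = X 2`.
theorem X_gap' (k : ℕ) (hk : 1 ≤ k) : 16 * ((e : ℝ) + 3) * X (k + 1) ≤ X (k + 2) := by
  obtain ⟨k, rfl⟩ := Nat.exists_eq_add_of_le' hk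
  refine le_trans ?_ (h.X_gap k)
  have h1 : (1 : ℝ) ≤ 2 ^ k := one_le_pow₀ (by norm_num)
  have h2 := h.X_pos (k + 2)
  show 16 * ((e : ℝ) + 3) * X (k + 2) ≤ _
  exact mul_le_mul_of_nonneg_right (le_mul_of_one_le_right (by positivity) h1) h2.le

/-- An integer vector with small truncation is, as far as the value of the form is concerned,
almost a multiple of `z k`. -/
theorem exists_approx (k : ℕ) (hk : 1 ≤ k) (v : Fin (e + 3) → ℤ)
    (hv : ‖truncate (intVec v)‖ ≤ X (k + 2) / (8 * (e + 3))) :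
    ∃ m : ℤ, |formHom α v - m * formHom α (z k)| ≤ (1 + |(m : ℝ)|) / 4 * formHom α (z k) ∧
      (|m| ≤ 1 → ∃ p : ℤ, v = m • z k + p • z (k + 1)) := by
  obtain ⟨m, p, q, r, hvr⟩ := h.exists_coeff k v
  set w := p • z (k + 1) + q • z (k + 2) + ∑ i ∈ Finset.range e, r i • y k (i + 1) with hw
  have hvw : v = m • z k + w := by rw [hvr, hw]; abel
  set S := |(p : ℝ)| * X (k + 1) + |(q : ℝ)| * X (k + 2) +
    ∑ i ∈ Finset.range e, |(r i : ℝ)| * X (k + 2) with hS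
  have hX1 := h.X_pos (k + 1)
  have hX2 := h.X_pos (k + 2)
  have hz := h.form_z_pos hα hd k
  have hwS : |formHom α w| ≤ S * (2 * formHom α (z k) / (c k * X (k + 2))) :=
    h.abs_form_le hα hd k p q r
  have hS1 : S ≤ 2 * (e + 3) * ‖truncate (intVec w)‖ := h.coeff_le k p q r
  have hw1 : truncate (intVec w) = truncate (intVec v) - (m : ℝ) • truncate (intVec (z k)) := by
    rw [hvw, truncate_intVec_add (m • z k), truncate_intVec_smul m, add_sub_cancel_left]
  have hw2 : ‖truncate (intVec w)‖ ≤ X (k + 2) / (8 * (e + 3)) +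
      |(m : ℝ)| * (2 * (X (k + 2) / (16 * (e + 3)))) := by
    rw [hw1]
    refine (norm_sub_le _ _).trans (add_le_add hv ?_)
    rw [norm_smul, Real.norm_eq_abs]
    gcongr
    refine (norm_truncate_le _).trans ((h.norm_z_le k hk).trans ?_)
    gcongr
    rw [le_div_iff₀ (by positivity), mul_comm]
    refine le_trans ?_ (h.X_gap' k hk)
    gcongr
    exact h.scale.monotone (by omega) (by omega)
  -- The constants 8 in the hypothesis and 16 in the gap make v and m z_k contribute 1/4 and |m|/4.
  have hS2 : S ≤ (1 + |(m : ℝ)|) / 4 * X (k + 2) := by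
    refine hS1.trans ((mul_le_mul_of_nonneg_left hw2 (by positivity)).trans_eq ?_)
    field_simp
    ring
  refine ⟨m, ?_, fun hm => ⟨p, ?_⟩⟩
  · have hc : (2 : ℝ) ≤ c k := by exact_mod_cast h.two_le_c k
    have : formHom α v - m * formHom α (z k) = formHom α w := by
      rw [hvw, map_add, map_zsmul, zsmul_eq_mul, add_sub_cancel_left]
    rw [this]
    calc |formHom α w| ≤ S * (2 * formHom α (z k) / (c k * X (k + 2))) := hwS
      _ ≤ (1 + |(m : ℝ)|) / 4 * X (k + 2) * (2 * formHom α (z k) / (2 * X (k + 2))) := by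
        gcongr
      _ = _ := by field_simp
  · have hm' : |(m : ℝ)| ≤ 1 := by exact_mod_cast hm
    -- A nonzero q or r_i would alone contribute at least `X (k + 2)` to S.
    have hS3 : S < X (k + 2) := by nlinarith
    have hsum : ∀ i ∈ Finset.range e, (0 : ℝ) ≤ |(r i : ℝ)| * X (k + 2) :=
      fun i _ => by positivity
    have hp0 : (0 : ℝ) ≤ |(p : ℝ)| * X (k + 1) := by positivity
    have hq0 : (0 : ℝ) ≤ |(q : ℝ)| * X (k + 2) := by positivity
    have hint : ∀ n : ℤ, |(n : ℝ)| * X (k + 2) < X (k + 2) → n = 0 := fun n hn => by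
      have h1 : |(n : ℝ)| < 1 := by
        by_contra! h2
        nlinarith
      exact Int.abs_lt_one_iff.1 (by exact_mod_cast h1)
    have hq : q = 0 := hint q (by linarith [Finset.sum_nonneg hsum])
    have hr : ∀ i ∈ Finset.range e, r i • y k (i + 1) = 0 := fun i hi => by
      rw [hint (r i) (by linarith [Finset.single_le_sum hsum hi]), zero_smul]
    rw [hvr, hq, Finset.sum_eq_zero hr]
    simp

/-- Excluding multiples of `z (k + 1)` forces m ≠ 0 in the approximation, and then |m| - (1 + |m|)/4
≥ 1/2. -/
theorem half_form_le (k : ℕ) (hk : 1 ≤ k) (v : Fin (e + 3) → ℤ)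
    (hv : ‖truncate (intVec v)‖ ≤ X (k + 2) / (8 * (e + 3)))
    (hne : ∀ p : ℤ, v ≠ p • z (k + 1)) : formHom α (z k) / 2 ≤ |formHom α v| := by
  obtain ⟨m, hm, hm1⟩ := h.exists_approx hα hd k hk v hv
  have hz := h.form_z_pos hα hd k
  have hm0 : m ≠ 0 := by
    rintro rfl
    obtain ⟨p, hp⟩ := hm1 (by simp)
    exact hne p (by simpa using hp)
  have hm2 : (1 : ℝ) ≤ |(m : ℝ)| := by exact_mod_cast Int.one_le_abs hm0
  have h1 : |m * formHom α (z k)| ≤ |formHom α v| + |formHom α v - m * formHom α (z k)| := by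
    have := abs_sub_abs_le_abs_sub (m * formHom α (z k)) (formHom α v)
    rw [abs_sub_comm] at this
    linarith
  rw [abs_mul, abs_of_pos hz] at h1
  nlinarith

/-- For |m| ≥ 2 the value is at least 5/4 of that at `z k`. Otherwise v = m z_k + p z_{k+1}, and the
obtuse angle leaves only coefficients for which both contributions to the value have the same sign.
-/
theorem minimal_form (k : ℕ) (hk : 1 ≤ k) (v : Fin (e + 3) → ℤ)
    (hv0 : truncate (intVec v) ≠ 0)
    (hv : ‖truncate (intVec v)‖ < ‖truncate (intVec (z (k + 1)))‖) :
    formHom α (z k) ≤ |formHom α v| ∧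
      (|formHom α v| ≤ formHom α (z k) → v = z k ∨ v = -z k) := by
  have hv1 : ‖truncate (intVec v)‖ ≤ X (k + 2) / (8 * (e + 3)) := by
    refine hv.le.trans ((norm_truncate_le _).trans ((h.norm_z_le (k + 1) (by omega)).trans ?_))
    rw [le_div_iff₀ (by positivity)]
    linarith [h.X_gap' k hk]
  obtain ⟨m, hm, hm1⟩ := h.exists_approx hα hd k hk v hv1
  have hz := h.form_z_pos hα hd k
  have hz1 := h.form_z_pos hα hd (k + 1)
  rcases le_or_gt |m| 1 with hm2 | hm2
  · obtain ⟨p, hp⟩ := hm1 hm2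
    have ht : truncate (intVec v) =
        (m : ℝ) • truncate (intVec (z k)) + (p : ℝ) • truncate (intVec (z (k + 1))) := by
      rw [hp, truncate_intVec_add, truncate_intVec_smul, truncate_intVec_smul]
    have hf : formHom α v = m * formHom α (z k) + p * formHom α (z (k + 1)) := by
      rw [hp, map_add, map_zsmul, map_zsmul, zsmul_eq_mul, zsmul_eq_mul]
    have hinner := h.inner_truncate_z_neg k hk
    set t₀ := truncate (intVec (z k))
    set t₁ := truncate (intVec (z (k + 1)))
    have hsq : ‖truncate (intVec v)‖ ^ 2 =
        (m : ℝ) ^ 2 * ‖t₀‖ ^ 2 + 2 * ((m : ℝ) * p * inner ℝ t₀ t₁) + (p : ℝ) ^ 2 * ‖t₁‖ ^ 2 := by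
      rw [ht, norm_add_sq_real, norm_smul, norm_smul, mul_pow, mul_pow, Real.norm_eq_abs,
        Real.norm_eq_abs, sq_abs, sq_abs, real_inner_smul_left, real_inner_smul_right]
      ring
    have hlt : ‖truncate (intVec v)‖ ^ 2 < ‖t₁‖ ^ 2 := by gcongr
    -- If p ≠ 0 and mp ≤ 0, the cross term is nonnegative and v would be at least as long as `z (k +
    -- 1)`.
    have hmp : p = 0 ∨ 0 < m * p := by
      by_contra! hcon
      have h1 : (m : ℝ) * p ≤ 0 := by exact_mod_cast hcon.2
      have h2 : (1 : ℝ) ≤ (p : ℝ) ^ 2 := by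
        have : (1 : ℤ) ≤ p ^ 2 := by have := sq_pos_of_ne_zero hcon.1; omega
        exact_mod_cast this
      have h3 : 0 ≤ (m : ℝ) * p * inner ℝ t₀ t₁ := mul_nonneg_of_nonpos_of_nonpos h1 hinner.le
      have h4 : ‖t₁‖ ^ 2 ≤ (p : ℝ) ^ 2 * ‖t₁‖ ^ 2 := le_mul_of_one_le_left (by positivity) h2
      have h5 : 0 ≤ (m : ℝ) ^ 2 * ‖t₀‖ ^ 2 := by positivity
      linarith
    have hm0 : m ≠ 0 := by
      rintro rfl
      have hp0 : p = 0 := by simpa using hmp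
      exact hv0 (by rw [ht, hp0]; simp)
    have hm3 : m = 1 ∨ m = -1 := by
      have := abs_le.1 hm2
      omega
    have hmp' : 0 ≤ (m : ℝ) * p := by
      rcases hmp with h1 | h1
      · simp [h1]
      · exact_mod_cast h1.le
    have habs : |formHom α v| = formHom α (z k) + |(p : ℝ)| * formHom α (z (k + 1)) := by
      rcases hm3 with rfl | rfl
      · have h1 : (0 : ℝ) ≤ p := by simpa using hmp'
        rw [hf, abs_of_nonneg h1, abs_of_nonneg (by push_cast; positivity)]
        push_cast; ring
      · have h1 : (p : ℝ) ≤ 0 := by simpa using hmp'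
        rw [hf, abs_of_nonpos h1, abs_of_nonpos (by push_cast; nlinarith)]
        push_cast; ring
    refine ⟨by rw [habs]; nlinarith [abs_nonneg (p : ℝ)], fun hle => ?_⟩
    have hp0 : p = 0 := by
      by_contra hp0
      have : (0 : ℝ) < |(p : ℝ)| := by positivity
      nlinarith
    rw [hp, hp0]
    rcases hm3 with rfl | rfl <;> simp
  · have hm3 : (2 : ℝ) ≤ |(m : ℝ)| := by exact_mod_cast hm2
    have h1 : |m * formHom α (z k)| ≤ |formHom α v| + |formHom α v - m * formHom α (z k)| := by
      have := abs_sub_abs_le_abs_sub (m * formHom α (z k)) (formHom α v)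
      rw [abs_sub_comm] at this
      linarith
    rw [abs_mul, abs_of_pos hz] at h1
    have h2 : formHom α (z k) < |formHom α v| := by nlinarith
    exact ⟨h2.le, fun h3 => absurd h3 (not_le.2 h2)⟩

omit h hα hd in
theorem one_le_norm_truncate (v : Fin (e + 3) → ℤ) (hv : truncate (intVec v) ≠ 0) :
    1 ≤ ‖truncate (intVec v)‖ := by
  have : ∃ i : Fin (e + 2), v i.castSucc ≠ 0 := by
    by_contra! hcon
    exact hv (PiLp.ext fun i => by
      show ((v (Fin.castSucc i) : ℤ) : ℝ) = 0
      rw [hcon]; simp)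
  obtain ⟨i, hi⟩ := this
  refine le_trans ?_ (abs_apply_le_norm_truncate (intVec v) (i := i.castSucc) i.2)
  have h1 : (1 : ℝ) ≤ |((v i.castSucc : ℤ) : ℝ)| := by exact_mod_cast Int.one_le_abs hi
  exact h1

omit hα hd in
theorem tendsto_X : Filter.Tendsto (fun k => (X (k + 2) : ℝ)) Filter.atTop Filter.atTop := by
  refine Filter.tendsto_atTop_mono (fun k => ?_)
    (tendsto_pow_atTop_atTop_of_one_lt (one_lt_two (α := ℝ)))
  induction k with
  | zero => simp [h.scale.two]
  | succ k ih =>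
    have h1 := h.X_gap k
    have h2 : (1 : ℝ) ≤ 2 ^ k := one_le_pow₀ (by norm_num)
    have h3 : (2 : ℝ) ≤ 16 * (e + 3) * 2 ^ k := by
      have : (0 : ℝ) ≤ e := by positivity
      nlinarith
    have h4 := h.X_pos (k + 2)
    calc (2 : ℝ) ^ (k + 1) = 2 * 2 ^ k := by ring
      _ ≤ 16 * (e + 3) * 2 ^ k * X (k + 2) := by gcongr
      _ ≤ _ := h1

theorem isBestApprox_iff (v : Fin (e + 3) → ℤ) :
    IsBestApprox α v ↔ ∃ k, 1 ≤ k ∧ (v = z k ∨ v = -z k) := by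
  constructor
  · rintro ⟨hv0, hv⟩
    have hex : ∃ k, ‖truncate (intVec v)‖ < ‖truncate (intVec (z (k + 2)))‖ := by
      obtain ⟨k, hk⟩ := (h.tendsto_X.eventually_gt_atTop (6 / 5 * ‖truncate (intVec v)‖)).exists
      exact ⟨k, by linarith [h.le_norm_truncate_z (k + 2) (by omega)]⟩
    classical
    -- Thus v lies between `z (k + 1)` and `z (k + 2)` in length; for k = 0 the lower bound holds
    -- because `z 1` has the least possible length 1.
    set k := Nat.find hex with hk
    have h1 : ‖truncate (intVec v)‖ < ‖truncate (intVec (z (k + 1 + 1)))‖ := Nat.find_spec hex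
    have h2 : ‖truncate (intVec (z (k + 1)))‖ ≤ ‖truncate (intVec v)‖ := by
      rcases Nat.eq_zero_or_pos k with h0 | h0
      · rw [h0, h.norm_truncate_z_one]
        exact one_le_norm_truncate v hv0
      · obtain ⟨j, hj⟩ := Nat.exists_eq_add_of_le' h0
        have := Nat.find_min hex (show j < Nat.find hex by omega)
        rw [hj]
        exact not_lt.1 this
    refine ⟨k + 1, by omega, (h.minimal_form hα hd (k + 1) (by omega) v hv0 h1).2 ?_⟩
    have h3 : 0 < ‖truncate (intVec (z (k + 1)))‖ :=
      lt_of_lt_of_le (by have := h.X_pos (k + 1); positivity)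
        (h.le_norm_truncate_z (k + 1) (by omega))
    have h4 := (hv (z (k + 1)) h3).1 h2
    rwa [← formHom_apply, ← formHom_apply, abs_of_pos (h.form_z_pos hα hd _)] at h4
  · rintro ⟨k, hk, hv⟩
    have hn : ‖truncate (intVec v)‖ = ‖truncate (intVec (z k))‖ := by
      rcases hv with rfl | rfl
      · rfl
      · rw [truncate_intVec_neg, norm_neg]
    have hf : |linForm α (intVec v)| = formHom α (z k) := by
      rw [← formHom_apply]
      rcases hv with rfl | rfl
      · exact abs_of_pos (h.form_z_pos hα hd _)
      · rw [map_neg, abs_neg, abs_of_pos (h.form_z_pos hα hd _)]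
    have h3 : 0 < ‖truncate (intVec (z k))‖ :=
      lt_of_lt_of_le (by have := h.X_pos k; positivity) (h.le_norm_truncate_z k hk)
    refine ⟨norm_pos_iff.1 (hn ▸ h3), fun v' hv' => ⟨fun hle => ?_, fun hlt => ?_⟩⟩
    · rw [hf]
      exact (h.minimal_form hα hd k hk v' (norm_pos_iff.1 hv')
        ((hle.trans_eq hn).trans_lt (h.norm_truncate_z_lt k hk))).1
    · rw [hf]
      rw [hn] at hlt
      obtain ⟨j, rfl⟩ := Nat.exists_eq_add_of_le' hk
      rcases Nat.eq_zero_or_pos j with h0 | h0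
      · rw [h0, h.norm_truncate_z_one] at hlt
        exact absurd hlt (not_lt.2 (one_le_norm_truncate v' (norm_pos_iff.1 hv')))
      · exact (h.form_z_succ_lt hα hd j).trans_le
          (h.minimal_form hα hd j h0 v' (norm_pos_iff.1 hv') hlt).1

end IsLatticeSystem

/-! ### Accumulation points of convergent sequences -/

open Filter Topology

/-- Near w there are only finitely many terms of the sequence, and those different from w can be
avoided. -/
theorem eventually_notMem_range {E : Type*} [TopologicalSpace E] [T2Space E] {s : ℕ → E} {u w : E}
    (hs : Tendsto s atTop (𝓝 u)) (hw : w ≠ u) : ∀ᶠ x in 𝓝[≠] w, x ∉ Set.range s := by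
  obtain ⟨A, B, hA, hB, hwA, huB, hAB⟩ := t2_separation hw
  obtain ⟨N, hN⟩ := eventually_atTop.1 (hs.eventually (hB.mem_nhds huB))
  have hfin : (s '' Set.Iio N \ {w}).Finite := ((Set.finite_Iio N).image s).subset Set.sdiff_subset
  have hF : (s '' Set.Iio N \ {w})ᶜ ∈ 𝓝 w := hfin.isClosed.isOpen_compl.mem_nhds (by simp)
  filter_upwards [nhdsWithin_le_nhds (hA.mem_nhds hwA), nhdsWithin_le_nhds hF,
    self_mem_nhdsWithin] with x hxA hxF hxw
  rintro ⟨j, rfl⟩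
  rcases lt_or_ge j N with hj | hj
  · exact hxF ⟨⟨j, hj, rfl⟩, hxw⟩
  · exact Set.disjoint_left.1 hAB hxA (hN j hj)

theorem accPt_of_tendsto {E : Type*} [TopologicalSpace E] {s : ℕ → E} {u : E} {D : Set E}
    (hs : Tendsto s atTop (𝓝 u)) (hne : ∀ j, s j ≠ u) (hD : ∀ j, s j ∈ D) : AccPt u (𝓟 D) :=
  accPt_iff_frequently.2 (hs.frequently (Frequently.of_forall fun j => ⟨hne j, hD j⟩))

/-- The accumulation points of the terms `± s j`, `± t j` of two convergent sequences that do not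
attain their limits. -/
theorem accPt_iff_of_tendsto {E : Type*} [NormedAddCommGroup E] {s t : ℕ → E} {u v : E}
    (hs : Tendsto s atTop (𝓝 u)) (ht : Tendsto t atTop (𝓝 v)) (hsu : ∀ j, s j ≠ u)
    (htv : ∀ j, t j ≠ v) {D : Set E}
    (hD : ∀ x, x ∈ D ↔ ∃ j, x = s j ∨ x = -s j ∨ x = t j ∨ x = -t j) (w : E) :
    AccPt w (𝓟 D) ↔ w = u ∨ w = -u ∨ w = v ∨ w = -v := by
  constructor
  · intro hw
    by_contra! hcon
    obtain ⟨h1, h2, h3, h4⟩ := hcon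
    have hev : ∀ᶠ x in 𝓝[≠] w, x ∉ D := by
      filter_upwards [eventually_notMem_range hs h1, eventually_notMem_range hs.neg h2,
        eventually_notMem_range ht h3, eventually_notMem_range ht.neg h4] with x hx1 hx2 hx3 hx4 hx
      obtain ⟨j, rfl | rfl | rfl | rfl⟩ := (hD x).1 hx
      exacts [hx1 ⟨j, rfl⟩, hx2 ⟨j, rfl⟩, hx3 ⟨j, rfl⟩, hx4 ⟨j, rfl⟩]
    rw [eventually_nhdsWithin_iff] at hev
    obtain ⟨x, ⟨hxw, hxD⟩, hx⟩ := ((accPt_iff_frequently.1 hw).and_eventually hev).exists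
    exact hx hxw hxD
  · rintro (rfl | rfl | rfl | rfl)
    · exact accPt_of_tendsto hs hsu fun j => (hD _).2 ⟨j, by simp⟩
    · exact accPt_of_tendsto hs.neg (fun j hj => hsu j (neg_injective hj))
        fun j => (hD _).2 ⟨j, by simp⟩
    · exact accPt_of_tendsto ht htv fun j => (hD _).2 ⟨j, by simp⟩
    · exact accPt_of_tendsto ht.neg (fun j hj => htv j (neg_injective hj))
        fun j => (hD _).2 ⟨j, by simp⟩

theorem mul_pow_rpow {Z : ℝ} (hZ : 0 < Z) (γ : ℝ) (n : ℕ) : Z ^ (-γ) * Z ^ n = Z ^ ((n : ℝ) - γ) := by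
  rw [← Real.rpow_natCast, ← Real.rpow_add hZ]
  congr 1; ring

/-! ### Exponents and asymptotic directions -/

namespace IsLatticeSystem

variable {e : ℕ} {X a c : ℕ → ℕ} {z : ℕ → Fin (e + 3) → ℤ} {y : ℕ → ℕ → Fin (e + 3) → ℤ}
  (h : IsLatticeSystem e X a c z y) {α : EuclideanSpace ℝ (Fin (e + 3))}
  (hα : α ∈ affinePlane (e + 3))
  (hd : ∀ k, IsDecreasingAt e (fun k => formHom α (z k)) (fun k i => formHom α (y k i)) k)

include h hα hd

theorem one_le_form_mul (k : ℕ) :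
    1 ≤ formHom α (z k) * (X (k + 1) * X (k + 2) ^ (e + 1)) := by
  have := volume_mono (h.form_rec α) hd h.scale k
  rwa [h.form_z_zero hα] at this

theorem form_mul_le (k : ℕ) :
    formHom α (z k) * (X (k + 1) * X (k + 2) ^ (e + 1)) ≤ 2 ^ (e + 1) := by
  have := volume_le (h.form_rec α) hd h.scale (by omega) (h.form_z_pos hα hd 0) k
  rwa [h.form_z_zero hα, mul_one] at this

omit hα hd in
theorem intVec_z_norm_ge (k : ℕ) (hk : 1 ≤ k) : (X k : ℝ) ≤ 2 * ‖intVec (z k)‖ := by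
  have h1 := h.le_norm_truncate_z k hk
  have h2 := norm_truncate_le (intVec (z k))
  linarith [norm_nonneg (intVec (z k))]

/-- The weight `X (k + 1) * X (k + 2) ^ (e + 1)` is of order `X k` to the power (1 + β) + (e + 1)(1
+ β)², and `X k` is of order ‖z k‖. -/
theorem exists_bounds_best {β C : ℝ} (hβ : 0 < β) (hC : 0 < C)
    (hX : ∀ k, (X (k + 1) : ℝ) ≤ C * (X k : ℝ) ^ (1 + β) ∧ (X k : ℝ) ^ (1 + β) ≤ C * X (k + 1)) :
    ∃ c₁ c₂ : ℝ, 0 < c₁ ∧ 0 < c₂ ∧ ∀ k, 1 ≤ k →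
      c₁ * ‖intVec (z k)‖ ^ (-((1 + β) * (1 + (e + 1) * (1 + β)))) ≤ formHom α (z k) ∧
      formHom α (z k) ≤ c₂ * ‖intVec (z k)‖ ^ (-((1 + β) * (1 + (e + 1) * (1 + β)))) := by
  set γ : ℝ := (1 + β) * (1 + (e + 1) * (1 + β)) with hγ
  have hγ0 : 0 < γ := by positivity
  have hβ1 : 0 < 1 + β := by linarith
  set C₁ : ℝ := C * (C * C ^ (1 + β)) ^ (e + 1) with hC₁
  have hC₁0 : 0 < C₁ := by positivity
  have hsplit : ∀ k, (X k : ℝ) ^ γ =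
      (X k : ℝ) ^ (1 + β) * (((X k : ℝ) ^ (1 + β)) ^ (1 + β)) ^ (e + 1) := fun k => by
    have hk := h.X_pos k
    rw [← Real.rpow_mul hk.le, ← Real.rpow_natCast, ← Real.rpow_mul hk.le, ← Real.rpow_add hk, hγ]
    congr 1
    push_cast
    ring
  have hup : ∀ k, (X (k + 1) * X (k + 2) ^ (e + 1) : ℝ) ≤ C₁ * (X k : ℝ) ^ γ := fun k => by
    have hk := h.X_pos k
    have h1 := (hX k).1
    have h2 : (X (k + 2) : ℝ) ≤ C * C ^ (1 + β) * ((X k : ℝ) ^ (1 + β)) ^ (1 + β) := by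
      refine ((hX (k + 1)).1).trans ?_
      rw [mul_assoc, ← Real.mul_rpow hC.le (by positivity)]
      gcongr
    calc (X (k + 1) * X (k + 2) ^ (e + 1) : ℝ)
        ≤ C * (X k : ℝ) ^ (1 + β) *
          (C * C ^ (1 + β) * ((X k : ℝ) ^ (1 + β)) ^ (1 + β)) ^ (e + 1) := by gcongr
      _ = _ := by rw [hsplit, hC₁, mul_pow (C * C ^ (1 + β))]; ring
  have hlow : ∀ k, (X k : ℝ) ^ γ ≤ C₁ * (X (k + 1) * X (k + 2) ^ (e + 1) : ℝ) := fun k => by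
    have hk := h.X_pos k
    have h1 := (hX k).2
    have h2 : ((X k : ℝ) ^ (1 + β)) ^ (1 + β) ≤ C * C ^ (1 + β) * X (k + 2) := by
      have h3 : ((X k : ℝ) ^ (1 + β)) ^ (1 + β) ≤ (C * X (k + 1)) ^ (1 + β) := by gcongr
      rw [Real.mul_rpow hC.le (by positivity)] at h3
      refine h3.trans ((mul_le_mul_of_nonneg_left (hX (k + 1)).2 (by positivity)).trans_eq ?_)
      ring
    rw [hsplit]
    calc (X k : ℝ) ^ (1 + β) * (((X k : ℝ) ^ (1 + β)) ^ (1 + β)) ^ (e + 1)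
        ≤ C * X (k + 1) * (C * C ^ (1 + β) * X (k + 2)) ^ (e + 1) := by gcongr
      _ = _ := by rw [hC₁, mul_pow (C * C ^ (1 + β))]; ring
  refine ⟨(C₁ * 2 ^ γ)⁻¹, 2 ^ (e + 1) * C₁ * 2 ^ γ, by positivity, by positivity,
    fun k hk => ?_⟩
  have hk0 := h.X_pos k
  have hk1 := h.X_pos (k + 1)
  have hk2 := h.X_pos (k + 2)
  have hz := h.form_z_pos hα hd k
  have hn2 := h.norm_z_le k hk
  have hn1 := h.intVec_z_norm_ge k hk
  have hn0 : 0 < ‖intVec (z k)‖ := by linarith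
  set Z := ‖intVec (z k)‖
  set G : ℝ := X (k + 1) * X (k + 2) ^ (e + 1) with hG
  have hG0 : 0 < G := by positivity
  have hZX : (X k : ℝ) ^ γ ≤ 2 ^ γ * Z ^ γ := by
    rw [← Real.mul_rpow (by norm_num) hn0.le]; gcongr
  have hXZ : Z ^ γ ≤ 2 ^ γ * (X k : ℝ) ^ γ := by
    rw [← Real.mul_rpow (by norm_num) hk0.le]; gcongr
  have h1 : 1 ≤ formHom α (z k) * G := h.one_le_form_mul hα hd k
  have h2 : formHom α (z k) * G ≤ 2 ^ (e + 1) := h.form_mul_le hα hd k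
  have hZγ : 0 < Z ^ γ := by positivity
  have h2γ : (0 : ℝ) < 2 ^ γ := by positivity
  constructor
  · rw [Real.rpow_neg hn0.le, ← mul_inv, inv_le_iff_one_le_mul₀ (by positivity)]
    refine h1.trans (mul_le_mul_of_nonneg_left ((hup k).trans ?_) hz.le)
    rw [mul_assoc C₁]
    exact mul_le_mul_of_nonneg_left hZX hC₁0.le
  · rw [Real.rpow_neg hn0.le, ← div_eq_mul_inv, le_div_iff₀ hZγ]
    calc formHom α (z k) * Z ^ γ ≤ formHom α (z k) * (2 ^ γ * (C₁ * G)) := by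
          refine mul_le_mul_of_nonneg_left (hXZ.trans ?_) hz.le
          exact mul_le_mul_of_nonneg_left (hlow k) h2γ.le
      _ = formHom α (z k) * G * (C₁ * 2 ^ γ) := by ring
      _ ≤ 2 ^ (e + 1) * (C₁ * 2 ^ γ) := by gcongr
      _ = _ := by ring

omit h hα hd in
theorem one_le_norm_intVec {d : ℕ} (v : Fin d → ℤ) (hv : v ≠ 0) : 1 ≤ ‖intVec v‖ := by
  obtain ⟨i, hi⟩ := Function.ne_iff.1 hv
  refine le_trans ?_ (PiLp.norm_apply_le (intVec v) i)
  have h1 : (1 : ℝ) ≤ |((v i : ℤ) : ℝ)| := by exact_mod_cast Int.one_le_abs hi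
  exact h1

/-- Choosing the least admissible scale makes `X (k + 2)` at most a constant times ‖v‖, while the
value is at least half of that at `z (k + 1)`. Only one application of the growth law is needed,
hence the smaller exponent. -/
theorem exists_bound_not_best {β C : ℝ} (hβ : 0 < β) (hC : 0 < C)
    (hX : ∀ k, (X (k + 1) : ℝ) ≤ C * (X k : ℝ) ^ (1 + β)) :
    ∃ c₃ : ℝ, 0 < c₃ ∧ ∀ v : Fin (e + 3) → ℤ, (∀ (p : ℤ) (k : ℕ), 1 ≤ k → v ≠ p • z k) →
      1 ≤ ‖intVec v‖ ∧
      c₃ * ‖intVec v‖ ^ (-(1 + (e + 1) * (1 + β))) ≤ |formHom α v| := by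
  set μ : ℝ := 1 + (e + 1) * (1 + β) with hμ
  have hμ0 : 0 < μ := by positivity
  refine ⟨(2 * (C ^ (e + 1) * (8 * (e + 3)) ^ μ))⁻¹, by positivity, fun v hv => ?_⟩
  have hZ1 : 1 ≤ ‖intVec v‖ := by
    apply one_le_norm_intVec
    rintro rfl
    exact hv 0 1 le_rfl (by simp)
  refine ⟨hZ1, ?_⟩
  have hex : ∃ k, ‖truncate (intVec v)‖ ≤ X (k + 3) / (8 * (e + 3)) := by
    obtain ⟨k, hk⟩ := ((h.tendsto_X.comp (tendsto_add_atTop_nat 1)).eventually_ge_atTop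
      (‖truncate (intVec v)‖ * (8 * (e + 3)))).exists
    exact ⟨k, (le_div_iff₀ (by positivity)).2 hk⟩
  classical
  set k := Nat.find hex with hk
  have h1 : ‖truncate (intVec v)‖ ≤ X (k + 3) / (8 * (e + 3)) := Nat.find_spec hex
  have h2 : (X (k + 2) : ℝ) ≤ 8 * (e + 3) * ‖intVec v‖ := by
    rcases Nat.eq_zero_or_pos k with h0 | h0
    · rw [h0, h.scale.two]
      have : (0 : ℝ) ≤ e := by positivity
      push_cast
      nlinarith
    · obtain ⟨j, hj⟩ := Nat.exists_eq_add_of_le' h0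
      have := Nat.find_min hex (show j < Nat.find hex by omega)
      rw [not_le, div_lt_iff₀ (by positivity)] at this
      rw [hj]
      have h3 := norm_truncate_le (intVec v)
      calc (X (j + 3) : ℝ) ≤ ‖truncate (intVec v)‖ * (8 * (e + 3)) := this.le
        _ ≤ ‖intVec v‖ * (8 * (e + 3)) := by gcongr
        _ = _ := by ring
  have h3 := h.half_form_le hα hd (k + 1) (by omega) v h1 (fun p => hv p _ (by omega))
  have h4 := h.one_le_form_mul hα hd (k + 1)
  have hz := h.form_z_pos hα hd (k + 1)
  have hk2 := h.X_pos (k + 2)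
  have hk3 := h.X_pos (k + 3)
  set Z := ‖intVec v‖
  have hZ0 : 0 < Z := by linarith
  have hpow : (X (k + 2) : ℝ) ^ μ = X (k + 2) * ((X (k + 2) : ℝ) ^ (1 + β)) ^ (e + 1) := by
    rw [← Real.rpow_natCast, ← Real.rpow_mul hk2.le, hμ, Real.rpow_add hk2 1, Real.rpow_one,
      mul_comm (1 + β)]
    push_cast
    rfl
  have h5 : (X (k + 2) * X (k + 3) ^ (e + 1) : ℝ) ≤
      C ^ (e + 1) * (8 * (e + 3)) ^ μ * Z ^ μ := by
    calc (X (k + 2) * X (k + 3) ^ (e + 1) : ℝ)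
        ≤ X (k + 2) * (C * (X (k + 2) : ℝ) ^ (1 + β)) ^ (e + 1) := by
          gcongr; exact hX (k + 2)
      _ = C ^ (e + 1) * ((X (k + 2) : ℝ) * ((X (k + 2) : ℝ) ^ (1 + β)) ^ (e + 1)) := by
          rw [mul_pow]; ring
      _ = C ^ (e + 1) * (X (k + 2) : ℝ) ^ μ := by
          rw [hpow]
      _ ≤ C ^ (e + 1) * (8 * (e + 3) * Z) ^ μ := by gcongr
      _ = _ := by rw [Real.mul_rpow (by positivity) hZ0.le]; ring
  rw [Real.rpow_neg hZ0.le, ← mul_inv, inv_le_iff_one_le_mul₀ (by positivity)]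
  have h6 : 1 ≤ formHom α (z (k + 1)) * (C ^ (e + 1) * (8 * (e + 3)) ^ μ * Z ^ μ) :=
    h4.trans (mul_le_mul_of_nonneg_left h5 hz.le)
  have h7 : 0 < C ^ (e + 1) * (8 * (e + 3)) ^ μ * Z ^ μ := by positivity
  nlinarith

omit h hα hd in
theorem norm_smul_intVec_neg {d : ℕ} (v : Fin d → ℤ) :
    ‖intVec (-v)‖⁻¹ • intVec (-v) = -(‖intVec v‖⁻¹ • intVec v) := by
  have : intVec (-v) = -intVec v := map_neg (intVecHom d) v
  rw [this, norm_neg, smul_neg]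

theorem mem_bestApproxDirections_iff (x : EuclideanSpace ℝ (Fin (e + 3))) :
    x ∈ bestApproxDirections α ↔ ∃ k, 1 ≤ k ∧ (x = ‖intVec (z k)‖⁻¹ • intVec (z k) ∨
      x = -(‖intVec (z k)‖⁻¹ • intVec (z k))) := by
  constructor
  · rintro ⟨v, hv, rfl⟩
    obtain ⟨k, hk, rfl | rfl⟩ := (h.isBestApprox_iff hα hd v).1 hv
    · exact ⟨k, hk, Or.inl rfl⟩
    · exact ⟨k, hk, Or.inr (norm_smul_intVec_neg _)⟩
  · rintro ⟨k, hk, rfl | rfl⟩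
    · exact ⟨z k, (h.isBestApprox_iff hα hd _).2 ⟨k, hk, Or.inl rfl⟩, rfl⟩
    · exact ⟨-z k, (h.isBestApprox_iff hα hd _).2 ⟨k, hk, Or.inr rfl⟩,
        (norm_smul_intVec_neg _).symm⟩

omit hα hd in
/-- The normalised vectors `z k` with `k` of fixed parity converge. -/
theorem exists_limit (m : ℕ) : ∃ U : EuclideanSpace ℝ (Fin (e + 3)),
    Tendsto (fun j => (X (2 * j + m + 1) : ℝ)⁻¹ • intVec (z (2 * j + m + 1))) atTop (𝓝 U) ∧
      ‖U - frame z (m + 1)‖ ≤ 1 / 6 := by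
  have hc : CauchySeq fun j => (X (2 * j + m + 1) : ℝ)⁻¹ • intVec (z (2 * j + m + 1)) := by
    refine cauchySeq_of_le_geometric (1 / 2) 1 (by norm_num) fun j => ?_
    rw [dist_comm, dist_eq_norm, one_mul, show 2 * (j + 1) + m + 1 = 2 * j + m + 3 by ring]
    exact (h.z_step (2 * j + m)).trans
      (pow_le_pow_of_le_one (by norm_num) (by norm_num) (by omega))
  obtain ⟨U, hU⟩ := cauchySeq_tendsto_of_complete hc
  refine ⟨U, hU, le_of_tendsto (hU.sub_const (frame z (m + 1))).norm (Eventually.of_forall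
    fun j => ?_)⟩
  have hf : frame z (2 * j + m + 1) = frame z (m + 1) := by
    simp [frame, Nat.even_add]
  rw [← hf]
  exact h.z_near' _ (by omega)

omit hα hd in
theorem tendsto_direction {m : ℕ} {U : EuclideanSpace ℝ (Fin (e + 3))} (hU0 : U ≠ 0)
    (hU : Tendsto (fun j => (X (2 * j + m + 1) : ℝ)⁻¹ • intVec (z (2 * j + m + 1))) atTop (𝓝 U)) :
    Tendsto (fun j => ‖intVec (z (2 * j + m + 1))‖⁻¹ • intVec (z (2 * j + m + 1))) atTop
      (𝓝 (‖U‖⁻¹ • U)) := by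
  refine ((hU.norm.inv₀ (norm_ne_zero_iff.2 hU0)).smul hU).congr fun j => ?_
  have hk := h.X_pos (2 * j + m + 1)
  rw [norm_smul, norm_inv, Real.norm_of_nonneg hk.le, mul_inv, inv_inv, smul_smul]
  congr 1
  field_simp

/-- The values at `z k` stay in [0, 1] while ‖z k‖ tends to infinity. -/
theorem form_limit_eq_zero {m : ℕ} {u : EuclideanSpace ℝ (Fin (e + 3))}
    (hu : Tendsto (fun j => ‖intVec (z (2 * j + m + 1))‖⁻¹ • intVec (z (2 * j + m + 1))) atTop
      (𝓝 u)) : linForm α u = 0 := by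
  have h1 : Tendsto (fun j => linForm α (‖intVec (z (2 * j + m + 1))‖⁻¹ •
      intVec (z (2 * j + m + 1)))) atTop (𝓝 (linForm α u)) := tendsto_const_nhds.inner hu
  have h2 : Tendsto (fun j => linForm α (‖intVec (z (2 * j + m + 1))‖⁻¹ •
      intVec (z (2 * j + m + 1)))) atTop (𝓝 0) := by
    have h3 : Tendsto (fun j => 2 / (X (2 * j + m + 1) : ℝ)) atTop (𝓝 0) := by
      have h4 : Tendsto (fun j => 2 * j + m + 1) atTop atTop :=
        tendsto_atTop_mono (fun j => by simp only [id_eq]; omega) tendsto_id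
      have h5 : Tendsto (fun k => (X k : ℝ)) atTop atTop :=
        (tendsto_add_atTop_iff_nat 2).1 h.tendsto_X
      exact (h5.comp h4).const_div_atTop 2
    refine squeeze_zero (fun j => ?_) (fun j => ?_) h3
    · rw [linForm, real_inner_smul_right]
      exact mul_nonneg (by positivity) (h.form_z_pos hα hd _).le
    · rw [linForm, real_inner_smul_right]
      have h5 : ∀ k, formHom α (z k) ≤ 1 := fun k => by
        induction k with
        | zero => exact (h.form_z_zero hα).le
        | succ k ih => exact (h.form_z_succ_lt hα hd k).le.trans ih
      have h6 := h.intVec_z_norm_ge (2 * j + m + 1) (by omega)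
      have h7 := h.X_pos (2 * j + m + 1)
      have h8 : 0 < ‖intVec (z (2 * j + m + 1))‖ := by linarith
      rw [inv_mul_eq_div, div_le_div_iff₀ h8 h7]
      have h9 : inner ℝ α (intVec (z (2 * j + m + 1))) ≤ (1 : ℝ) := h5 _
      nlinarith
  exact tendsto_nhds_unique h1 h2

omit hα hd in
-- The first two coordinates suffice: they are near (1, 0) for U and near (-1, 1) for V.
theorem limits_not_parallel {U V : EuclideanSpace ℝ (Fin (e + 3))}
    (hU : ‖U - intVec (z 1)‖ ≤ 1 / 6) (hV : ‖V - intVec (z 2)‖ ≤ 1 / 6) (ρ : ℝ) : U ≠ ρ • V := by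
  rintro rfl
  have hcoord : ∀ (A B : EuclideanSpace ℝ (Fin (e + 3))) (i : Fin (e + 3)), ‖A - B‖ ≤ 1 / 6 →
      |A i - B i| ≤ 1 / 6 := fun A B i hAB => (PiLp.norm_apply_le (A - B) i).trans hAB
  have h0 := abs_le.1 (hcoord _ _ ⟨0, by omega⟩ hU)
  have h1 := abs_le.1 (hcoord _ _ ⟨1, by omega⟩ hU)
  have h2 := abs_le.1 (hcoord _ _ ⟨0, by omega⟩ hV)
  have h3 := abs_le.1 (hcoord _ _ ⟨1, by omega⟩ hV)
  simp only [h.z_one, h.intVec_z_two, PiLp.sub_apply, PiLp.smul_apply, smul_eq_mul,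
    intVec_stdVec_apply] at h0 h1 h2 h3
  norm_num at h0 h1 h2 h3
  rcases le_or_gt 0 ρ with hρ | hρ <;> nlinarith

/-- The form vanishes at the limit but is positive at every `z k`. -/
theorem direction_ne_limit {m : ℕ} {u : EuclideanSpace ℝ (Fin (e + 3))}
    (hu : Tendsto (fun j => ‖intVec (z (2 * j + m + 1))‖⁻¹ • intVec (z (2 * j + m + 1))) atTop
      (𝓝 u)) (j : ℕ) : ‖intVec (z (2 * j + m + 1))‖⁻¹ • intVec (z (2 * j + m + 1)) ≠ u := by
  intro hj
  have h1 := h.form_limit_eq_zero hα hd hu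
  rw [← hj, linForm, real_inner_smul_right] at h1
  have h6 := h.intVec_z_norm_ge (2 * j + m + 1) (by omega)
  have h7 := h.X_pos (2 * j + m + 1)
  have h8 : 0 < ‖intVec (z (2 * j + m + 1))‖ := by linarith
  exact (mul_pos (inv_pos.2 h8) (h.form_z_pos hα hd (2 * j + m + 1))).ne' h1

theorem mem_bestApproxDirections_iff' (x : EuclideanSpace ℝ (Fin (e + 3))) :
    x ∈ bestApproxDirections α ↔ ∃ j,
      x = ‖intVec (z (2 * j + 0 + 1))‖⁻¹ • intVec (z (2 * j + 0 + 1)) ∨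
      x = -(‖intVec (z (2 * j + 0 + 1))‖⁻¹ • intVec (z (2 * j + 0 + 1))) ∨
      x = ‖intVec (z (2 * j + 1 + 1))‖⁻¹ • intVec (z (2 * j + 1 + 1)) ∨
      x = -(‖intVec (z (2 * j + 1 + 1))‖⁻¹ • intVec (z (2 * j + 1 + 1))) := by
  rw [h.mem_bestApproxDirections_iff hα hd]
  constructor
  · rintro ⟨k, hk, hx⟩
    obtain ⟨j, rfl | rfl⟩ : ∃ j, k = 2 * j + 0 + 1 ∨ k = 2 * j + 1 + 1 :=
      ⟨(k - 1) / 2, by omega⟩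
    · exact ⟨j, hx.imp_right Or.inl⟩
    · exact ⟨j, Or.inr (Or.inr hx)⟩
  · rintro ⟨j, hx | hx | hx | hx⟩
    exacts [⟨_, by omega, Or.inl hx⟩, ⟨_, by omega, Or.inr hx⟩, ⟨_, by omega, Or.inl hx⟩,
      ⟨_, by omega, Or.inr hx⟩]

omit h hα hd in
theorem unit_vectors_ne {E : Type*} [NormedAddCommGroup E] [NormedSpace ℝ E] {U V : E}
    (hU : U ≠ 0) (hpar : ∀ ρ : ℝ, U ≠ ρ • V) (ρ : ℝ) : ‖U‖⁻¹ • U ≠ ρ • (‖V‖⁻¹ • V) := fun hρ =>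
  hpar (‖U‖ * (ρ * ‖V‖⁻¹)) (by
    rw [← smul_smul, ← smul_smul, ← hρ, smul_smul, mul_inv_cancel₀ (norm_ne_zero_iff.2 hU),
      one_smul])

omit hα hd in
theorem one_le_norm_z_two : 1 ≤ ‖intVec (z 2)‖ := by
  nlinarith [h.norm_z_two_sq, norm_nonneg (intVec (z 2))]

theorem asymptoticDirections_eq : ∃ u v : EuclideanSpace ℝ (Fin (e + 3)), u ≠ v ∧ u ≠ -v ∧
    asymptoticDirections α = {u, -u, v, -v} := by
  obtain ⟨U, hU, hU1⟩ := h.exists_limit 0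
  obtain ⟨V, hV, hV1⟩ := h.exists_limit 1
  have hU2 : ‖U - intVec (z 1)‖ ≤ 1 / 6 := by simpa [frame] using hU1
  have hV2 : ‖V - intVec (z 2)‖ ≤ 1 / 6 := by simpa [frame] using hV1
  have hpar := h.limits_not_parallel hU2 hV2
  have hU0 : U ≠ 0 := fun h0 => hpar 0 (by rw [h0, zero_smul])
  have hV0 : V ≠ 0 := fun h0 => by
    rw [h0, zero_sub, norm_neg] at hV2
    linarith [h.one_le_norm_z_two]
  have hu := h.tendsto_direction (m := 0) hU0 hU
  have hv := h.tendsto_direction (m := 1) hV0 hV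
  have hparn := unit_vectors_ne hU0 hpar
  have hun : ‖‖U‖⁻¹ • U‖ = 1 := norm_smul_inv_norm (𝕜 := ℝ) hU0
  have hvn : ‖‖V‖⁻¹ • V‖ = 1 := norm_smul_inv_norm (𝕜 := ℝ) hV0
  generalize ‖U‖⁻¹ • U = u at *
  generalize ‖V‖⁻¹ • V = v at *
  refine ⟨u, v, fun huv => hparn 1 (by rw [one_smul, huv]),
    fun huv => hparn (-1) (by rw [neg_smul, one_smul, huv]), ?_⟩
  ext w
  have key := accPt_iff_of_tendsto hu hv (h.direction_ne_limit hα hd (m := 0) hu)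
    (h.direction_ne_limit hα hd (m := 1) hv) (h.mem_bestApproxDirections_iff' hα hd) w
  refine ⟨fun hw => key.1 hw.2, fun hw => ⟨?_, key.2 hw⟩⟩
  rcases hw with rfl | rfl | rfl | rfl
  exacts [hun, by rw [norm_neg, hun], hvn, by rw [norm_neg, hvn]]

end IsLatticeSystem

end DiophForm

/-! ### Assembly -/

theorem theorem2 (d : ℕ) (hd : 3 ≤ d) (β : ℝ) (hβ : 0 < β) :
    ∃ α ∈ DiophForm.affinePlane d,
      (∃ c C : ℝ, 0 < c ∧ 0 < C ∧ ∀ z : Fin d → ℤ, DiophForm.IsBestApprox α z →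
        c * ‖DiophForm.intVec z‖ ^ (-DiophForm.typeExponent d β) ≤
            |DiophForm.linForm α (DiophForm.intVec z)| * ‖DiophForm.intVec z‖ ^ (d - 1) ∧
        |DiophForm.linForm α (DiophForm.intVec z)| * ‖DiophForm.intVec z‖ ^ (d - 1) ≤
            C * ‖DiophForm.intVec z‖ ^ (-DiophForm.typeExponent d β)) ∧
      (∃ c : ℝ, 0 < c ∧ ∀ z : Fin d → ℤ,
        (¬ ∃ (m : ℤ) (w : Fin d → ℤ), DiophForm.IsBestApprox α w ∧ z = m • w) →
        c * ‖DiophForm.intVec z‖ ^ (-DiophForm.typeExponent d β + ((d : ℝ) - 1) * β) ≤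
            |DiophForm.linForm α (DiophForm.intVec z)| * ‖DiophForm.intVec z‖ ^ (d - 1)) ∧
      (∃ u v : EuclideanSpace ℝ (Fin d), u ≠ v ∧ u ≠ -v ∧
        DiophForm.asymptoticDirections α = {u, -u, v, -v}) := by
  obtain ⟨e, rfl⟩ := Nat.exists_eq_add_of_le' hd
  obtain ⟨X, a, c, hscale, C, hC, hX⟩ := DiophForm.exists_scale hβ (e + 3)
  obtain ⟨z, y, h⟩ := DiophForm.exists_latticeSystem e hscale
  obtain ⟨α, hα, hdec⟩ := h.exists_form_decreasing
  refine ⟨α, hα, ?_, ?_, h.asymptoticDirections_eq hα hdec⟩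
  · obtain ⟨c₁, c₂, hc₁, hc₂, hb⟩ := h.exists_bounds_best hα hdec hβ hC hX
    refine ⟨c₁, c₂, hc₁, hc₂, fun v hv => ?_⟩
    obtain ⟨k, hk, hv⟩ := (h.isBestApprox_iff hα hdec v).1 hv
    have hn : ‖DiophForm.intVec v‖ = ‖DiophForm.intVec (z k)‖ := by
      rcases hv with rfl | rfl
      · rfl
      · rw [← DiophForm.intVecHom_apply, map_neg, norm_neg, DiophForm.intVecHom_apply]
    have hf : |DiophForm.linForm α (DiophForm.intVec v)| = DiophForm.formHom α (z k) := by
      rw [← DiophForm.formHom_apply]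
      rcases hv with rfl | rfl
      · exact abs_of_pos (h.form_z_pos hα hdec _)
      · rw [map_neg, abs_neg, abs_of_pos (h.form_z_pos hα hdec _)]
    rw [hn, hf]
    obtain ⟨h1, h2⟩ := hb k hk
    have hZ : 0 < ‖DiophForm.intVec (z k)‖ := by
      have := h.intVec_z_norm_ge k hk
      have := h.X_pos k
      linarith
    have key := DiophForm.mul_pow_rpow hZ ((1 + β) * (1 + (e + 1) * (1 + β))) (e + 2)
    rw [show ((e + 2 : ℕ) : ℝ) - (1 + β) * (1 + (e + 1) * (1 + β)) =
      -DiophForm.typeExponent (e + 3) β by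
        rw [DiophForm.typeExponent]; push_cast; ring] at key
    rw [← key, ← mul_assoc, ← mul_assoc]
    exact ⟨mul_le_mul_of_nonneg_right h1 (by positivity),
      mul_le_mul_of_nonneg_right h2 (by positivity)⟩
  · obtain ⟨c₃, hc₃, hb⟩ := h.exists_bound_not_best hα hdec hβ hC fun k => (hX k).1
    refine ⟨c₃, hc₃, fun v hv => ?_⟩
    obtain ⟨hZ, h1⟩ := hb v fun p k hk hvk =>
      hv ⟨p, z k, (h.isBestApprox_iff hα hdec _).2 ⟨k, hk, Or.inl rfl⟩, hvk⟩
    have hZ0 : 0 < ‖DiophForm.intVec v‖ := by linarith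
    have key := DiophForm.mul_pow_rpow hZ0 (1 + (e + 1) * (1 + β)) (e + 2)
    -- The exponent obtained is -(d - 2)β, larger than the required one by (d - 2)β²; since ‖v‖ ≥ 1
    -- this is enough.
    have h2 : -DiophForm.typeExponent (e + 3) β + (((e + 3 : ℕ) : ℝ) - 1) * β ≤
        ((e + 2 : ℕ) : ℝ) - (1 + (e + 1) * (1 + β)) := by
      rw [DiophForm.typeExponent]
      push_cast
      have : 0 ≤ ((e : ℝ) + 1) * β ^ 2 := by positivity
      linarith
    refine (mul_le_mul_of_nonneg_left (Real.rpow_le_rpow_of_exponent_le hZ h2) hc₃.le).trans ?_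
    rw [← key, ← mul_assoc]
    exact mul_le_mul_of_nonneg_right h1 (by positivity)
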